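/- **Setting.** Let $d\ge 1$, $\beta\in(0,1]$ and let $\gamma,\rho,F,L,\lambda_0,\sigma_0,\bar p,a_-,r_-,a_+,r_+,\kappa,\tau>0$. Write $B(x,t)$ for the closed Euclidean ball in $\mathbb R^d$. - $\mathcal P=\mathcal P(\bar p,a_-,r_-,a_+,r_+)$ is the class of probability distributions $P$ on $\mathbb R^d$ with a Lebesgue density $p\ge 0$ such that $\|p\|_\infty\le\bar p$; $P(B(x,t))\ge a_-p(x)t^d$ for all $x\in\mathbb R^d$, $t\in(0,r_-]$; and $P(B(x,t))\le a_+p(x)t^d$ for all $x$ with $p(x)>0$ and all $t\in(0,r_+]$. - For densities $p,q$ put $\mathcal T(t)=\int q(x)/p(x)^{t}\,dx$ (the integrand is $+\infty$ where $p=0<q$ and $0$ where $p=q=0$). - Let $P_X\in\mathcal P$ have density $p$, and let $Q_X\in\mathcal P$ have density $q$ with $\mathcal T(\gamma)<\infty$ (density ratio exponent $\gamma$) and $\int q(x)^{d/(\rho+d)}\,dx<\infty$. - Let $f:\mathbb R^d\to\mathbb R$ satisfy $|f|\le F$ and $|f(x)-f(y)|\le L\|x-y\|^\beta$ for all $x,y$.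 Under covariate shift the source and the target follow the same regression model $Y=f(X)+\varepsilon$, with $X\sim P_X$ for the source and $X\sim Q_X$ for the target, and with noise $\varepsilon$ independent of $X$, of the same law in both cases, such that $\mathbb E[\varepsilon]=0$ and $\mathbb E[e^{\lambda_0|\varepsilon|}]\le\sigma_0$. - Let $(X_1,Y_1),\dots,(X_n,Y_n)$ be an i.i.d. sample from the source. For $x\in\mathbb R^d$ let $Y_i(x)$ be the label of the $i$-th nearest neighbour of $x$ among $X_1,\dots,X_n$ (ties broken by the smaller index). The standard $k$-NN regressor is $\hat f(x)=\frac1k\sum_{i=1}^kY_i(x)$. **Constants.** Put $$r=\frac{2\beta}{2\beta+d}\wedge\frac{\gamma}{\gamma+1},\qquad u=\frac{2\beta}{d}\wedge\gamma,\qquad k=\big\lceil\kappa\log(n)^{1-r}n^{r}\big\rceil,$$ $$K_d=1\vee 2(25/d)^d,\qquad C_\tau=\frac{\log K_d+2d+\tau+1}{H},\qquad H=\frac{\lambda_0^2}{8\sigma_0},$$ and, for $K\ge1$, $$K_0=2K(2d+1)(4e)^{2d+1},\qquad a=2d+\tau+\frac{\log K_0}{\log(2d)},\qquad \lambda_\tau=\frac{4a+9}{4a+12},\qquad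 B_\tau=\frac{2}{1-\lambda_\tau}.$$ **Theorem.** There is an integer $N=N(\gamma,\beta,d,\kappa,\tau)\ge 2d\vee3$, depending on nothing else, such that for every $n\ge N$ we have $1\le k\le n$ and, for all the other data above and every $K\ge1$ (in particular for any universal constant $K \geq 1$ for which the indicators of balls in $\mathbb R^d$ have, for every $d$, every $\epsilon\in(0,1)$ and every probability measure, $L^1$ covering numbers at most $K(2d+1)(4e)^{2d+1}\epsilon^{-2d}$), with probability at least $1-2n^{-\tau}$, $$\int\big(\hat f(x)-f(x)\big)^2\,dQ_X(x)\ \le\ \left[\frac{2C_\tau}{\kappa}+\big(2L^2r_-^{2\beta}+8F^2\big)\Big(\frac{\kappa B_\tau}{a_-r_-^d}\Big)^{u}\,\mathcal T(u)\right]\Big(\frac{\log n}{n}\Big)^{r}.$$ -/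

import Mathlib

open MeasureTheory ProbabilityTheory
open scoped ENNReal

namespace CovShift

noncomputable section

/-- The covariate space `ℝ^d` with its Euclidean norm. -/
abbrev Cov (d : ℕ) : Type := EuclideanSpace ℝ (Fin d)

/-- The Hölder ball: `‖f‖_∞ ≤ F` and `|f x - f y| ≤ L ‖x - y‖ ^ β`. -/
structure InHolderBall {d : ℕ} (β F L : ℝ) (f : Cov d → ℝ) : Prop where
  bound : ∀ x, |f x| ≤ F
  holder : ∀ x y, |f x - f y| ≤ L * ‖x - y‖ ^ β

/-- `ν` is the law of a centred noise variable with `E[exp (lam0 |ε|)] ≤ sig0`. -/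
structure IsNoiseLaw (lam0 sig0 : ℝ) (ν : Measure ℝ) : Prop where
  isProb : IsProbabilityMeasure ν
  integrable : Integrable (fun e : ℝ => e) ν
  centered : ∫ e, e ∂ν = 0
  expMoment : ∫⁻ e, ENNReal.ofReal (Real.exp (lam0 * |e|)) ∂ν ≤ ENNReal.ofReal sig0

/-- The joint law of `(X, Y)` where `Y = f X + ε`, `X` has law `P`, `ε` has law `ν`, and `ε` is
independent of `X`. Under covariate shift the source and the target joint laws are
`regressionLaw P f ν` and `regressionLaw Q f ν`: same `f`, same noise, different marginals. -/
def regressionLaw {d : ℕ} (P : Measure (Cov d)) (f : Cov d → ℝ) (ν : Measure ℝ) :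
    Measure (Cov d × ℝ) :=
  (P.prod ν).map (fun z => (z.1, f z.1 + z.2))

/-- `P` is a probability distribution on `ℝ^d` with Lebesgue density `p`, `‖p‖_∞ ≤ pbar`. -/
structure HasBoundedDensity {d : ℕ} (pbar : ℝ) (P : Measure (Cov d)) (p : Cov d → ℝ) : Prop where
  isProb : IsProbabilityMeasure P
  measurable : Measurable p
  nonneg : ∀ x, 0 ≤ p x
  eq_withDensity : P = volume.withDensity (fun x => ENNReal.ofReal (p x))
  bound : ∀ᵐ x, p x ≤ pbar

/-- The class of distributions with bounded density that satisfy the minimal mass property with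
parameters `am, rm` and the maximal mass property with parameters `ap, rp`. -/
structure InMassClass {d : ℕ} (pbar am rm ap rp : ℝ) (P : Measure (Cov d)) (p : Cov d → ℝ) :
    Prop extends HasBoundedDensity pbar P p where
  minimalMass : ∀ x, ∀ r : ℝ, 0 < r → r ≤ rm →
    ENNReal.ofReal (am * p x * r ^ d) ≤ P (Metric.closedBall x r)
  maximalMass : ∀ x, 0 < p x → ∀ r : ℝ, 0 < r → r ≤ rp →
    P (Metric.closedBall x r) ≤ ENNReal.ofReal (ap * p x * r ^ d)

/-- `T(t) = ∫ q(x) / p(x)^t dx`, with values in `[0, ∞]`. For `t > 0` the integrand is `∞` where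
`p = 0 < q` and is `0` where `p = q = 0`. -/
def densityRatioMoment {d : ℕ} (p q : Cov d → ℝ) (t : ℝ) : ℝ≥0∞ :=
  ∫⁻ x, ENNReal.ofReal (q x) / ENNReal.ofReal (p x) ^ t

/-- The class of target distributions `Q` (with density `q`) associated with a source
distribution of density `p`: `Q` is in the mass class, the pair has density ratio exponent `γ`,
and `Q` satisfies the pseudo-moment condition of order `ρ`. -/
structure InTargetClass {d : ℕ} (pbar am rm ap rp γ ρ : ℝ) (p : Cov d → ℝ)
    (Q : Measure (Cov d)) (q : Cov d → ℝ) : Prop extends InMassClass pbar am rm ap rp Q q where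
  densityRatio : densityRatioMoment p q γ < ∞
  pseudoMoment : ∫⁻ x, ENNReal.ofReal (q x) ^ ((d : ℝ) / (ρ + d)) < ∞

/-- The permutation ordering the sample points by their distance to `x`, ties being broken by the
smaller index: `neighbourOrder s x i` is the index of the `(i+1)`-st nearest neighbour of `x`. -/
def neighbourOrder {d n : ℕ} (s : Fin n → Cov d × ℝ) (x : Cov d) : Equiv.Perm (Fin n) :=
  Tuple.sort (fun i => ‖x - (s i).1‖)

theorem neighbourOrder_monotone {d n : ℕ} (s : Fin n → Cov d × ℝ) (x : Cov d) :
    Monotone (fun i => ‖x - (s (neighbourOrder s x i)).1‖) :=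
  Tuple.monotone_sort (fun i => ‖x - (s i).1‖)

/-- The local nearest neighbour regressor with neighbour function `k`, based on the sample `s`;
the standard regressor is the case of a constant function `k`. -/
def knnRegressor {d n : ℕ} (k : Cov d → ℕ) (s : Fin n → Cov d × ℝ) (x : Cov d) : ℝ :=
  (1 / (k x : ℝ)) * ∑ i : Fin n, if (i : ℕ) + 1 ≤ k x then (s (neighbourOrder s x i)).2 else 0

/-- The risk `∫ (g - f)^2 dQ`, i.e. the squared `L²(Q)` distance, with values in `[0, ∞]`. -/
def l2Risk {d : ℕ} (Q : Measure (Cov d)) (g f : Cov d → ℝ) : ℝ≥0∞ :=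
  ∫⁻ x, ENNReal.ofReal ((g x - f x) ^ 2) ∂Q

/-- `r = 2β/(2β+d) ∧ γ/(γ+1)`. -/
def rateExponent (d : ℕ) (β γ : ℝ) : ℝ :=
  min (2 * β / (2 * β + d)) (γ / (γ + 1))

/-- `u = 2β/d ∧ γ`. -/
def momentExponent (d : ℕ) (β γ : ℝ) : ℝ :=
  min (2 * β / d) γ

/-- `k = ⌈κ log(n)^(1-r) n^r⌉`. -/
def neighbourCount (κ r : ℝ) (n : ℕ) : ℕ :=
  ⌈κ * Real.log n ^ (1 - r) * (n : ℝ) ^ r⌉₊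

/-- `K_d = 2 (25/d)^d`, replaced by `1` where this is smaller than `1`. -/
def permConst (d : ℕ) : ℝ :=
  max 1 (2 * (25 / (d : ℝ)) ^ d)

/-- `C_τ = (log K_d + 2d + τ + 1) / H` with `H = lam0² / (8 sig0)`. -/
def varConst (d : ℕ) (lam0 sig0 τ : ℝ) : ℝ :=
  (Real.log (permConst d) + 2 * d + τ + 1) / (lam0 ^ 2 / (8 * sig0))

/-- `K_0 = 2 K (2d+1) (4e)^(2d+1)`. -/
def coverConst (d : ℕ) (K : ℝ) : ℝ :=
  2 * K * (2 * d + 1) * (4 * Real.exp 1) ^ (2 * d + 1)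

/-- `λ_τ = (4 a + 9) / (4 a + 12)` with `a = 2d + τ + log K_0 / log (2d)`. -/
def deviationConst (d : ℕ) (K τ : ℝ) : ℝ :=
  (4 * (2 * d + τ + Real.log (coverConst d K) / Real.log (2 * d)) + 9) /
    (4 * (2 * d + τ + Real.log (coverConst d K) / Real.log (2 * d)) + 12)

/-- `B_τ = 2 / (1 - λ_τ)`. -/
def massConst (d : ℕ) (K τ : ℝ) : ℝ :=
  2 / (1 - deviationConst d K τ)

/-- The constant `2 C_τ / κ + (2 L² rm^(2β) + 8 F²) (κ B_τ / (am rm^d))^u T(u)`; here `T` stands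
for the finite number `∫ q / p^u`. -/
def riskConst (d : ℕ) (β γ F L am rm lam0 sig0 κ τ K T : ℝ) : ℝ :=
  2 * varConst d lam0 sig0 τ / κ +
    (2 * L ^ 2 * rm ^ (2 * β) + 8 * F ^ 2) *
      (κ * massConst d K τ / (am * rm ^ d)) ^ momentExponent d β γ * T

end

end CovShift

namespace CovShift

/-! ### Real inequalities -/

/-! The regressor is `noiseMean + signalMean`, so the risk is at most twice the squared `L²(Q)` norm
of the noise plus twice the integrated squared bias.

Noise: freeze the design. At each `x`, `k` times the noise mean is a sum of at most `k` independent
centred variables, so its hyperbolic cosine has a sub-Gaussian expectation bound that does not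
depend on `x`. Since `s ↦ cosh √s` is convex, Jensen's inequality under `Q` moves this bound to the
`L²(Q)` norm itself (`cosh_le_lintegral_cosh`). Tonelli and Markov then give `measure_noise_ge_le`,
without any union bound over neighbour sets.

Bias: take the radius at which minimal mass guarantees a ball of mass `4k/n`. By a Chernoff bound a
given point has fewer than `k` sample points in that ball with probability at most `e^(-k)`.
Averaging over `Q` and applying Markov, the sparse points have `Q`-mass below `e^(-k) n^τ` outside
an event of probability `n^(-τ)` (`measure_sparseSet_ge_le`). Elsewhere Hölder continuity, or the
trivial bound `2F` where `p` is small, bounds the squared bias by a multiple of `(k/(n p(x)))^u`,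
whose `Q`-integral is controlled by `T(u)` (`ofReal_bias_le`).

The identity `u (1 - r) = r` turns `(k/n)^u` into the rate. The mass `4k/n` costs a constant `8κ`,
while the claim allows `κ B_τ ≥ 13κ`; the gap absorbs the sparse points for large `n`. -/

theorem succ_mul_pow_mul_sub_le {x c : ℝ} (hx : 0 ≤ x) (hc : 0 ≤ c) (m : ℕ) :
    (m + 1) * c ^ m * (x - c) ≤ x ^ (m + 1) - c ^ (m + 1) := by
  induction m with
  | zero => simp
  | succ m ih =>
    have h1 := mul_le_mul_of_nonneg_left ih hx
    -- This is exactly the slack between `x` times the induction hypothesis and the next case.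
    have h2 : 0 ≤ (m + 1) * c ^ m * (x - c) ^ 2 := by positivity
    push_cast
    have e1 : x ^ (m + 1 + 1) = x * x ^ (m + 1) := by ring
    have e2 : c ^ (m + 1 + 1) = c * c ^ (m + 1) := by ring
    have e3 : c ^ (m + 1) = c * c ^ m := by ring
    rw [e1, e2]
    rw [e3] at h1 ⊢
    nlinarith

/-- As a function of `y ^ 2`, the hyperbolic cosine lies above its tangents. -/
theorem exists_cosh_tangent {b : ℝ} (hb : 0 < b) :
    ∃ D, 0 < D ∧ ∀ y, Real.cosh b + D * (y ^ 2 - b ^ 2) ≤ Real.cosh y := by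
  -- The slope is the derivative of `s ↦ cosh √s` at `s = b ^ 2`.
  refine ⟨Real.sinh b / (2 * b), div_pos (Real.sinh_pos_iff.2 hb) (by positivity), fun y => ?_⟩
  have hs := ((Real.hasSum_sinh b).div_const (2 * b)).mul_right (y ^ 2 - b ^ 2)
  have hcy := (hasSum_nat_add_iff' 1).2 (Real.hasSum_cosh y)
  have hcb := (hasSum_nat_add_iff' 1).2 (Real.hasSum_cosh b)
  -- The power series are compared term by term: each term is the tangent inequality for `s ^ (m +
  -- 1)` at `s = b ^ 2`.
  have := hasSum_le (fun m => ?_) hs (hcy.sub hcb)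
  · simp at this
    linarith
  · have h := succ_mul_pow_mul_sub_le (sq_nonneg y) (sq_nonneg b) m
    have hf : ((2 * (m + 1)).factorial : ℝ) = (2 * (m + 1)) * ((2 * m + 1).factorial : ℝ) := by
      rw [show 2 * (m + 1) = (2 * m + 1) + 1 by ring, Nat.factorial_succ]
      push_cast
      ring
    have hp : (0 : ℝ) < ((2 * m + 1).factorial : ℝ) := by positivity
    have e : b ^ (2 * m + 1) / ((2 * m + 1).factorial : ℝ) / (2 * b) * (y ^ 2 - b ^ 2)
        = ((m + 1) * (b ^ 2) ^ m * (y ^ 2 - b ^ 2)) / ((2 * (m + 1)).factorial : ℝ) := by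
      rw [hf, ← pow_mul]
      field_simp
      ring
    rw [e, ← sub_div, pow_mul, pow_mul]
    gcongr

/-- A second-order Taylor bound with remainder `z ^ 2 * exp |z|`, `z = θ e`. As `|z|` is at most a
quarter of `lam |e|`, the other three quarters of the exponent absorb the square. -/
theorem exp_le_one_add_add {lam θ : ℝ} (hlam : 0 < lam) (hθ : |θ| ≤ lam / 4) (e : ℝ) :
    Real.exp (θ * e) ≤ 1 + θ * e + 2 * (θ / lam) ^ 2 * Real.exp (lam * |e|) := by
  have h1 : Real.exp (θ * e) - (1 + θ * e) ≤ |θ * e| ^ 2 * Real.exp |θ * e| := by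
    have h := Complex.norm_exp_sub_sum_le_norm_mul_exp ((θ * e : ℝ) : ℂ) 2
    have h' : Complex.exp ((θ * e : ℝ) : ℂ) - ∑ m ∈ Finset.range 2,
        ((θ * e : ℝ) : ℂ) ^ m / (m.factorial : ℂ)
        = ((Real.exp (θ * e) - (1 + θ * e) : ℝ) : ℂ) := by
      simp [Finset.sum_range_succ]
    rw [h', Complex.norm_real, Complex.norm_real, Real.norm_eq_abs, Real.norm_eq_abs] at h
    exact (le_abs_self _).trans h
  set w := lam * |e| with hw
  have hw0 : 0 ≤ w := by positivity
  have h2 : |θ * e| ≤ w / 4 := by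
    rw [abs_mul, hw]
    nlinarith [abs_nonneg e]
  have h3 : |θ * e| ^ 2 = (θ / lam) ^ 2 * w ^ 2 := by
    rw [hw, sq_abs, mul_pow, mul_pow, sq_abs, div_pow]
    field_simp
  have h4 : w ^ 2 ≤ 2 * Real.exp (3 * w / 4) := by
    have hq := Real.quadratic_le_exp_of_nonneg (show 0 ≤ 3 * w / 8 by positivity)
    -- The constant `18/25` exceeds `1/√2`, so squaring gives the factor `2`.
    have hlin : 18 / 25 * w ≤ Real.exp (3 * w / 8) := by
      nlinarith [sq_nonneg (w - 3)]
    have e1 : Real.exp (3 * w / 4) = Real.exp (3 * w / 8) ^ 2 := by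
      rw [← Real.exp_nat_mul]
      congr 1
      push_cast
      ring
    rw [e1]
    nlinarith [Real.exp_pos (3 * w / 8)]
  have h5 : |θ * e| ^ 2 * Real.exp |θ * e| ≤ 2 * (θ / lam) ^ 2 * Real.exp w := by
    rw [h3]
    calc (θ / lam) ^ 2 * w ^ 2 * Real.exp |θ * e|
        ≤ (θ / lam) ^ 2 * (2 * Real.exp (3 * w / 4)) * Real.exp (w / 4) := by gcongr
      _ = 2 * (θ / lam) ^ 2 * (Real.exp (3 * w / 4) * Real.exp (w / 4)) := by ring
      _ = 2 * (θ / lam) ^ 2 * Real.exp w := by rw [← Real.exp_add]; ring_nf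
  linarith

/-! ### Moment generating functions of noise variables -/

theorem IsNoiseLaw.one_le {lam0 sig0 : ℝ} {ν : Measure ℝ} (hlam : 0 < lam0)
    (h : IsNoiseLaw lam0 sig0 ν) : 1 ≤ sig0 := by
  have := h.isProb
  have h1 : ∫⁻ _ : ℝ, ENNReal.ofReal 1 ∂ν ≤ ENNReal.ofReal sig0 :=
    (lintegral_mono fun e => ENNReal.ofReal_le_ofReal (Real.one_le_exp (by positivity))).trans
      h.expMoment
  simp only [ENNReal.ofReal_one, lintegral_const, measure_univ, mul_one] at h1
  simpa using h1

/-- Integrating the pointwise bound kills the linear term by centring; `1 + y ≤ exp y` finishes. -/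
theorem IsNoiseLaw.lintegral_exp_mul_le {lam0 sig0 θ : ℝ} {ν : Measure ℝ} (hlam : 0 < lam0)
    (h : IsNoiseLaw lam0 sig0 ν) (hθ : |θ| ≤ lam0 / 4) :
    ∫⁻ e, ENNReal.ofReal (Real.exp (θ * e)) ∂ν
      ≤ ENNReal.ofReal (Real.exp (2 * sig0 / lam0 ^ 2 * θ ^ 2)) := by
  have := h.isProb
  have hs := h.one_le hlam
  have hm : Measurable fun e : ℝ => Real.exp (lam0 * |e|) := by fun_prop
  have hint : Integrable (fun e : ℝ => Real.exp (lam0 * |e|)) ν := by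
    refine ⟨hm.aestronglyMeasurable, ?_⟩
    rw [hasFiniteIntegral_iff_ofReal (ae_of_all _ fun e => (Real.exp_pos _).le)]
    exact h.expMoment.trans_lt ENNReal.ofReal_lt_top
  have hle : ∫ e, Real.exp (lam0 * |e|) ∂ν ≤ sig0 := by
    have h2 := h.expMoment
    rw [← ofReal_integral_eq_lintegral_ofReal hint (ae_of_all _ fun e => (Real.exp_pos _).le)]
      at h2
    exact (ENNReal.ofReal_le_ofReal_iff (by linarith)).1 h2
  have hint1 : Integrable (fun e : ℝ => 1 + θ * e) ν :=
    (integrable_const 1).add (h.integrable.const_mul θ)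
  have hint2 : Integrable (fun e : ℝ => 2 * (θ / lam0) ^ 2 * Real.exp (lam0 * |e|)) ν :=
    hint.const_mul _
  have hpt := exp_le_one_add_add hlam hθ
  calc ∫⁻ e, ENNReal.ofReal (Real.exp (θ * e)) ∂ν
      ≤ ∫⁻ e, ENNReal.ofReal (1 + θ * e + 2 * (θ / lam0) ^ 2 * Real.exp (lam0 * |e|)) ∂ν :=
        lintegral_mono fun e => ENNReal.ofReal_le_ofReal (hpt e)
    _ = ENNReal.ofReal (∫ e, (1 + θ * e + 2 * (θ / lam0) ^ 2 * Real.exp (lam0 * |e|)) ∂ν) :=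
        (ofReal_integral_eq_lintegral_ofReal (hint1.add hint2)
          (ae_of_all _ fun e => (Real.exp_pos _).le.trans (hpt e))).symm
    _ ≤ _ := by
        apply ENNReal.ofReal_le_ofReal
        rw [integral_add hint1 hint2, integral_add (integrable_const 1) (h.integrable.const_mul θ),
          integral_const_mul, integral_const_mul, h.centered]
        simp only [integral_const, probReal_univ, smul_eq_mul, mul_one, mul_zero, add_zero]
        have h3 : 2 * (θ / lam0) ^ 2 * ∫ e, Real.exp (lam0 * |e|) ∂ν
            ≤ 2 * sig0 / lam0 ^ 2 * θ ^ 2 := by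
          calc _ ≤ 2 * (θ / lam0) ^ 2 * sig0 := by gcongr
            _ = _ := by field_simp
        linarith [Real.add_one_le_exp (2 * sig0 / lam0 ^ 2 * θ ^ 2)]

theorem lintegral_pi_prod {ι α : Type*} [Fintype ι] [MeasurableSpace α] (P : Measure α)
    [IsProbabilityMeasure P] (A : Finset ι) {g : α → ℝ≥0∞} (hg : Measurable g) :
    ∫⁻ x, ∏ i ∈ A, g (x i) ∂(Measure.pi fun _ : ι => P) = (∫⁻ x, g x ∂P) ^ A.card := by
  have hind := iIndepFun_pi (μ := fun _ : ι => P) (X := fun _ => g) (fun _ => hg.aemeasurable)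
  rw [lintegral_prod_eq_prod_lintegral_of_indepFun A _ hind
    (fun i => hg.comp (measurable_pi_apply i))]
  rw [← Finset.prod_const]
  refine Finset.prod_congr rfl fun i _ => ?_
  exact (measurePreserving_eval (fun _ : ι => P) i).lintegral_comp hg

theorem IsNoiseLaw.lintegral_exp_sum_le {ι : Type*} [Fintype ι] {lam0 sig0 θ : ℝ} {ν : Measure ℝ}
    (hlam : 0 < lam0) (h : IsNoiseLaw lam0 sig0 ν) (hθ : |θ| ≤ lam0 / 4) (A : Finset ι) :
    ∫⁻ e, ENNReal.ofReal (Real.exp (θ * ∑ i ∈ A, e i)) ∂(Measure.pi fun _ : ι => ν)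
      ≤ ENNReal.ofReal (Real.exp (A.card * (2 * sig0 / lam0 ^ 2 * θ ^ 2))) := by
  have := h.isProb
  have e1 : ∀ e : ι → ℝ, ENNReal.ofReal (Real.exp (θ * ∑ i ∈ A, e i))
      = ∏ i ∈ A, ENNReal.ofReal (Real.exp (θ * e i)) := fun e => by
    rw [← ENNReal.ofReal_prod_of_nonneg (fun _ _ => (Real.exp_pos _).le), ← Real.exp_sum,
      Finset.mul_sum]
  simp_rw [e1]
  rw [lintegral_pi_prod ν A (g := fun t => ENNReal.ofReal (Real.exp (θ * t))) (by fun_prop),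
    Real.exp_nat_mul, ENNReal.ofReal_pow (Real.exp_pos _).le]
  gcongr
  exact h.lintegral_exp_mul_le hlam hθ

theorem IsNoiseLaw.lintegral_cosh_sum_le {ι : Type*} [Fintype ι] {lam0 sig0 θ : ℝ}
    {ν : Measure ℝ} (hlam : 0 < lam0) (h : IsNoiseLaw lam0 sig0 ν) (hθ : |θ| ≤ lam0 / 4)
    (A : Finset ι) :
    ∫⁻ e, ENNReal.ofReal (Real.cosh (θ * ∑ i ∈ A, e i)) ∂(Measure.pi fun _ : ι => ν)
      ≤ ENNReal.ofReal (Real.exp (A.card * (2 * sig0 / lam0 ^ 2 * θ ^ 2))) := by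
  have h1 := h.lintegral_exp_sum_le hlam hθ A
  have h2 := h.lintegral_exp_sum_le hlam (θ := -θ) (by rwa [abs_neg]) A
  rw [neg_sq] at h2
  have e1 : ∀ e : ι → ℝ, ENNReal.ofReal (Real.cosh (θ * ∑ i ∈ A, e i))
      = 2⁻¹ * (ENNReal.ofReal (Real.exp (θ * ∑ i ∈ A, e i))
        + ENNReal.ofReal (Real.exp (-θ * ∑ i ∈ A, e i))) := fun e => by
    rw [Real.cosh_eq, ← ENNReal.ofReal_add (Real.exp_pos _).le (Real.exp_pos _).le, neg_mul,
      div_eq_inv_mul, ENNReal.ofReal_mul (by norm_num), ENNReal.ofReal_inv_of_pos (by norm_num)]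
    simp
  simp_rw [e1]
  rw [lintegral_const_mul _ (by fun_prop), lintegral_add_left (by fun_prop)]
  calc _ ≤ 2⁻¹ * (ENNReal.ofReal (Real.exp (A.card * (2 * sig0 / lam0 ^ 2 * θ ^ 2)))
        + ENNReal.ofReal (Real.exp (A.card * (2 * sig0 / lam0 ^ 2 * θ ^ 2)))) := by gcongr
    _ = _ := by
      rw [← two_mul, ← mul_assoc, ENNReal.inv_mul_cancel (by norm_num) (by norm_num), one_mul]

/-- Jensen's inequality for the hyperbolic cosine of a root mean square. -/
theorem cosh_le_lintegral_cosh {α : Type*} [MeasurableSpace α] (Q : Measure α)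
    [IsProbabilityMeasure Q] {g : α → ℝ} (hg : Measurable g) {b : ℝ} (hb : 0 < b)
    (h : ENNReal.ofReal (b ^ 2) ≤ ∫⁻ x, ENNReal.ofReal (g x ^ 2) ∂Q) :
    ENNReal.ofReal (Real.cosh b) ≤ ∫⁻ x, ENNReal.ofReal (Real.cosh (g x)) ∂Q := by
  obtain ⟨D, hD, ht⟩ := exists_cosh_tangent hb
  -- The negative part of the tangent is moved across, so that all terms are nonnegative and no
  -- integrability of `g ^ 2` is needed.
  have hpt : ∀ x, ENNReal.ofReal (Real.cosh b) + ENNReal.ofReal D * ENNReal.ofReal (g x ^ 2)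
      ≤ ENNReal.ofReal (Real.cosh (g x)) + ENNReal.ofReal D * ENNReal.ofReal (b ^ 2) := fun x => by
    rw [← ENNReal.ofReal_mul hD.le, ← ENNReal.ofReal_mul hD.le,
      ← ENNReal.ofReal_add (Real.cosh_pos _).le (by positivity),
      ← ENNReal.ofReal_add (Real.cosh_pos _).le (by positivity)]
    apply ENNReal.ofReal_le_ofReal
    linarith [ht (g x)]
  have hi := lintegral_mono (μ := Q) hpt
  rw [lintegral_add_left measurable_const, lintegral_add_right _ measurable_const,
    lintegral_const_mul _ (by fun_prop)] at hi
  simp only [lintegral_const, measure_univ, mul_one] at hi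
  refine (ENNReal.add_le_add_iff_right (a := ENNReal.ofReal D * ENNReal.ofReal (b ^ 2)) ?_).1
    (le_trans ?_ hi)
  · exact ENNReal.mul_ne_top ENNReal.ofReal_ne_top ENNReal.ofReal_ne_top
  · gcongr

/-! ### The lower tail of a binomial count -/

open Classical in
-- Chernoff's method with exponent `-1`: since `e⁻¹ ≤ 1/2`, `E[e^(-count)] ≤ (1 - P(B)/2)^n`. Mass
-- `4k/n` makes this at most `e^(-2k)`, and Markov at level `e^(-k)` loses half the exponent.
theorem measure_card_lt_le {α : Type*} [MeasurableSpace α] (P : Measure α)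
    [IsProbabilityMeasure P] {B : Set α} (hB : MeasurableSet B) {n k : ℕ} (hn : 0 < n)
    (h : ENNReal.ofReal (4 * k / n) ≤ P B) :
    (Measure.pi fun _ : Fin n => P) {x | (Finset.univ.filter fun i => x i ∈ B).card < k}
      ≤ ENNReal.ofReal (Real.exp (-k)) := by
  set g : α → ℝ≥0∞ := fun x => ENNReal.ofReal (if x ∈ B then Real.exp (-1) else 1) with hg
  have hgm : Measurable g :=
    (Measurable.ite hB measurable_const measurable_const).ennreal_ofReal
  have hmean : ∫⁻ x, g x ∂P ≤ ENNReal.ofReal (Real.exp (-(2 * k / n))) := by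
    have hpt : ∀ x, g x + B.indicator (fun _ => ENNReal.ofReal (1 / 2)) x ≤ 1 := fun x => by
      by_cases hx : x ∈ B
      · simp only [hg, hx, if_true, Set.indicator_of_mem]
        rw [← ENNReal.ofReal_add (Real.exp_pos _).le (by norm_num), ← ENNReal.ofReal_one]
        apply ENNReal.ofReal_le_ofReal
        have : Real.exp (-1) ≤ 1 / 2 := by
          rw [Real.exp_neg, ← one_div]
          exact one_div_le_one_div_of_le (by norm_num) (by linarith [Real.add_one_le_exp 1])
        linarith
      · simp [hg, hx]
    have hi := lintegral_mono (μ := P) hpt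
    rw [lintegral_add_left hgm, lintegral_indicator_const hB] at hi
    simp only [lintegral_const, measure_univ, mul_one] at hi
    have h2 : ∫⁻ x, g x ∂P + ENNReal.ofReal (2 * k / n) ≤ 1 := by
      refine le_trans ?_ hi
      gcongr
      calc ENNReal.ofReal (2 * k / n) = ENNReal.ofReal (1 / 2) * ENNReal.ofReal (4 * k / n) := by
            rw [← ENNReal.ofReal_mul (by norm_num)]
            congr 1
            ring
        _ ≤ _ := by gcongr
    calc ∫⁻ x, g x ∂P ≤ 1 - ENNReal.ofReal (2 * k / n) :=
          ENNReal.le_sub_of_add_le_right ENNReal.ofReal_ne_top h2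
      _ = ENNReal.ofReal (1 - 2 * k / n) := by
          rw [ENNReal.ofReal_sub _ (by positivity), ENNReal.ofReal_one]
      _ ≤ _ := ENNReal.ofReal_le_ofReal (by linarith [Real.add_one_le_exp (-(2 * k / n : ℝ))])
  have hprod : ∫⁻ x, ∏ i, g (x i) ∂(Measure.pi fun _ : Fin n => P)
      ≤ ENNReal.ofReal (Real.exp (-(2 * k))) := by
    rw [lintegral_pi_prod P Finset.univ hgm, Finset.card_univ, Fintype.card_fin]
    calc _ ≤ ENNReal.ofReal (Real.exp (-(2 * k / n))) ^ n := by gcongr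
      _ = _ := by
        rw [← ENNReal.ofReal_pow (Real.exp_pos _).le, ← Real.exp_nat_mul]
        congr 2
        field_simp
  have hsub : {x : Fin n → α | (Finset.univ.filter fun i => x i ∈ B).card < k}
      ⊆ {x | ENNReal.ofReal (Real.exp (-k)) ≤ ∏ i, g (x i)} := fun x hx => by
    simp only [Set.mem_ofPred_eq] at hx ⊢
    simp only [hg]
    rw [← ENNReal.ofReal_prod_of_nonneg
      (fun i _ => by split_ifs; exacts [(Real.exp_pos _).le, zero_le_one]),
      Finset.prod_ite, Finset.prod_const, Finset.prod_const_one, mul_one, ← Real.exp_nat_mul]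
    apply ENNReal.ofReal_le_ofReal
    apply Real.exp_le_exp.2
    have : (((Finset.univ.filter fun i => x i ∈ B).card : ℕ) : ℝ) ≤ k := by exact_mod_cast hx.le
    linarith
  calc _ ≤ _ := measure_mono hsub
    _ ≤ (∫⁻ x, ∏ i, g (x i) ∂(Measure.pi fun _ : Fin n => P)) / ENNReal.ofReal (Real.exp (-k)) :=
        meas_ge_le_lintegral_div
          (Finset.measurable_prod _ fun i _ => hgm.comp (measurable_pi_apply i)).aemeasurable
          (by simp [Real.exp_pos]) ENNReal.ofReal_ne_top
    _ ≤ ENNReal.ofReal (Real.exp (-(2 * k))) / ENNReal.ofReal (Real.exp (-k)) := by gcongr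
    _ = _ := by
        rw [← ENNReal.ofReal_div_of_pos (Real.exp_pos _), ← Real.exp_sub]
        congr 2
        ring

/-! ### Measurability of the regressor -/

/-- Sortedness with ties broken by index is a finite system of comparisons of distances. -/
theorem measurableSet_neighbourOrder_eq {d n : ℕ} (σ : Equiv.Perm (Fin n)) :
    MeasurableSet {z : (Fin n → Cov d × ℝ) × Cov d | neighbourOrder z.1 z.2 = σ} := by
  have e : ∀ z : (Fin n → Cov d × ℝ) × Cov d, neighbourOrder z.1 z.2 = σ ↔
      (∀ i j, i ≤ j → ‖z.2 - (z.1 (σ i)).1‖ ≤ ‖z.2 - (z.1 (σ j)).1‖) ∧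
      ∀ i j, i < j → ‖z.2 - (z.1 (σ i)).1‖ = ‖z.2 - (z.1 (σ j)).1‖ → σ i < σ j := fun z => by
    rw [neighbourOrder, eq_comm, Tuple.eq_sort_iff]
    rfl
  have hm : ∀ i, Measurable fun z : (Fin n → Cov d × ℝ) × Cov d => ‖z.2 - (z.1 (σ i)).1‖ :=
    fun i => by fun_prop
  simp_rw [e]
  refine measurableSet_setOfPred.2 (Measurable.and ?_ ?_)
  · refine Measurable.forall fun i => Measurable.forall fun j => Measurable.imp measurable_const ?_
    exact measurableSet_setOfPred.1 (measurableSet_le (hm i) (hm j))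
  · refine Measurable.forall fun i => Measurable.forall fun j => Measurable.imp measurable_const ?_
    exact Measurable.imp (measurableSet_setOfPred.1 (measurableSet_eq_fun (hm i) (hm j)))
      measurable_const

theorem measurable_knnRegressor {d n : ℕ} (k : ℕ) :
    Measurable fun z : (Fin n → Cov d × ℝ) × Cov d => knnRegressor (fun _ => k) z.1 z.2 := by
  have e : ∀ z : (Fin n → Cov d × ℝ) × Cov d, knnRegressor (fun _ => k) z.1 z.2 =
      ∑ σ : Equiv.Perm (Fin n), if neighbourOrder z.1 z.2 = σ then
        (1 / (k : ℝ)) * ∑ i : Fin n, if (i : ℕ) + 1 ≤ k then (z.1 (σ i)).2 else 0 else 0 :=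
    fun z => by
      rw [Finset.sum_ite_eq, if_pos (Finset.mem_univ _)]
      rfl
  simp_rw [e]
  refine Finset.measurable_sum _ fun σ _ => Measurable.ite (measurableSet_neighbourOrder_eq σ) ?_
    measurable_const
  refine Measurable.const_mul (Finset.measurable_sum _ fun i _ => ?_) _
  split_ifs
  · fun_prop
  · exact measurable_const

/-- The average of the residuals `y - f x` of the `k` nearest neighbours. -/
noncomputable def noiseMean {d n : ℕ} (k : ℕ) (f : Cov d → ℝ) (s : Fin n → Cov d × ℝ)
    (x : Cov d) : ℝ :=
  knnRegressor (fun _ => k) (fun i => ((s i).1, (s i).2 - f (s i).1)) x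

/-- The average of the values of `f` at the `k` nearest neighbours. -/
noncomputable def signalMean {d n : ℕ} (k : ℕ) (f : Cov d → ℝ) (s : Fin n → Cov d × ℝ)
    (x : Cov d) : ℝ :=
  knnRegressor (fun _ => k) (fun i => ((s i).1, f (s i).1)) x

theorem knnRegressor_eq_add {d n : ℕ} (k : ℕ) (f : Cov d → ℝ) (s : Fin n → Cov d × ℝ)
    (x : Cov d) :
    knnRegressor (fun _ => k) s x = noiseMean k f s x + signalMean k f s x := by
  simp only [knnRegressor, noiseMean, signalMean, ← mul_add, ← Finset.sum_add_distrib]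
  congr 1
  refine Finset.sum_congr rfl fun i _ => ?_
  -- The order depends on the covariates only, so changing labels leaves it alone.
  have h1 : neighbourOrder (fun i => ((s i).1, (s i).2 - f (s i).1)) x = neighbourOrder s x := rfl
  have h2 : neighbourOrder (fun i => ((s i).1, f (s i).1)) x = neighbourOrder s x := rfl
  rw [h1, h2]
  split_ifs <;> simp

theorem measurable_noiseMean {d n : ℕ} (k : ℕ) {f : Cov d → ℝ} (hf : Measurable f) :
    Measurable fun z : (Fin n → Cov d × ℝ) × Cov d => noiseMean k f z.1 z.2 := by
  refine (measurable_knnRegressor (d := d) (n := n) k).comp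
    (g := fun z => knnRegressor (fun _ => k) z.1 z.2)
    (f := fun z : (Fin n → Cov d × ℝ) × Cov d =>
      ((fun i => ((z.1 i).1, (z.1 i).2 - f (z.1 i).1)), z.2)) ?_
  fun_prop

/-! ### The law of the sample -/

instance isProbabilityMeasure_regressionLaw {d : ℕ} (P : Measure (Cov d)) (ν : Measure ℝ)
    [IsProbabilityMeasure P] [IsProbabilityMeasure ν] (f : Cov d → ℝ) [hf : Fact (Measurable f)] :
    IsProbabilityMeasure (regressionLaw P f ν) := by
  have := hf.out
  exact Measure.isProbabilityMeasure_map (by fun_prop)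

theorem regressionLaw_preimage_fst {d : ℕ} (P : Measure (Cov d)) (ν : Measure ℝ)
    [IsProbabilityMeasure P] [IsProbabilityMeasure ν] {f : Cov d → ℝ} (hf : Measurable f)
    {B : Set (Cov d)} (hB : MeasurableSet B) :
    regressionLaw P f ν (Prod.fst ⁻¹' B) = P B := by
  rw [regressionLaw, Measure.map_apply (by fun_prop) (measurable_fst hB)]
  have : (fun z : Cov d × ℝ => (z.1, f z.1 + z.2)) ⁻¹' (Prod.fst ⁻¹' B) = B ×ˢ Set.univ := by
    ext z
    simp
  rw [this, Measure.prod_prod, measure_univ, mul_one]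

/-- Separates design from noise, so that the noise can be integrated first with the design frozen.
-/
theorem pi_regressionLaw_eq_map {d n : ℕ} (P : Measure (Cov d)) (ν : Measure ℝ)
    [IsProbabilityMeasure P] [IsProbabilityMeasure ν] {f : Cov d → ℝ} (hf : Measurable f) :
    Measure.pi (fun _ : Fin n => regressionLaw P f ν)
      = ((Measure.pi fun _ : Fin n => P).prod (Measure.pi fun _ : Fin n => ν)).map
        (fun z i => (z.1 i, f (z.1 i) + z.2 i)) := by
  have : Fact (Measurable f) := ⟨hf⟩
  have hm : Measurable (fun z : Cov d × ℝ => (z.1, f z.1 + z.2)) := by fun_prop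
  have h1 := measurePreserving_arrowProdEquivProdArrow (Cov d) ℝ (Fin n) (fun _ => P) (fun _ => ν)
  have : ∀ _ : Fin n, IsProbabilityMeasure
      ((P.prod ν).map (fun z : Cov d × ℝ => (z.1, f z.1 + z.2))) := fun _ =>
    Measure.isProbabilityMeasure_map hm.aemeasurable
  have h2 := Measure.pi_map_pi (μ := fun _ : Fin n => P.prod ν)
    (f := fun _ => fun z : Cov d × ℝ => (z.1, f z.1 + z.2)) (fun _ => hm.aemeasurable)
  rw [← h1.map_eq, Measure.map_map (by fun_prop) h1.measurable]
  exact h2.symm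

/-! ### The noise term -/

/-- The set `A` consists of the indices of the `k` nearest neighbours and depends on the design
only, not on `e`. Only `≤ k` holds for its size, since `k > n` is not excluded. -/
theorem mul_noiseMean_eq_sum {d n k : ℕ} (hk : 0 < k) (f : Cov d → ℝ) (X : Fin n → Cov d)
    (x : Cov d) :
    ∃ A : Finset (Fin n), A.card ≤ k ∧ ∀ e : Fin n → ℝ,
      k * noiseMean k f (fun i => (X i, f (X i) + e i)) x = ∑ i ∈ A, e i := by
  set σ := Tuple.sort fun i => ‖x - X i‖
  refine ⟨(Finset.univ.filter fun i : Fin n => (i : ℕ) + 1 ≤ k).map σ.toEmbedding, ?_, fun e => ?_⟩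
  · rw [Finset.card_map]
    calc _ = ((Finset.univ.filter fun i : Fin n => (i : ℕ) + 1 ≤ k).image Fin.val).card :=
          (Finset.card_image_of_injective _ Fin.val_injective).symm
      _ ≤ (Finset.range k).card := Finset.card_le_card fun j hj => by
          simp only [Finset.mem_image, Finset.mem_filter] at hj
          obtain ⟨i, ⟨_, hi⟩, rfl⟩ := hj
          exact Finset.mem_range.2 hi
      _ = k := Finset.card_range k
  · have hk' : (k : ℝ) ≠ 0 := by positivity
    rw [Finset.sum_map, Finset.sum_filter, noiseMean, knnRegressor, ← mul_assoc,
      mul_one_div_cancel hk', one_mul]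
    refine Finset.sum_congr rfl fun i _ => ?_
    simp only [add_sub_cancel_left]
    rfl

theorem lintegral_lintegral_le_of_forall {α δ : Type*} [MeasurableSpace α] [MeasurableSpace δ]
    (μ : Measure α) (ν : Measure δ) [SFinite μ] [IsProbabilityMeasure ν] {g : α × δ → ℝ≥0∞}
    (hg : Measurable g) {C : ℝ≥0∞} (h : ∀ y, ∫⁻ x, g (x, y) ∂μ ≤ C) :
    ∫⁻ x, ∫⁻ y, g (x, y) ∂ν ∂μ ≤ C := by
  rw [lintegral_lintegral_swap (f := fun x y => g (x, y)) hg.aemeasurable]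
  exact (lintegral_mono h).trans (by simp)

theorem lintegral_cosh_noiseMean_le {d n k : ℕ} (hk : 0 < k) {lam0 sig0 θ : ℝ} (hlam : 0 < lam0)
    {ν : Measure ℝ} (hν : IsNoiseLaw lam0 sig0 ν) (hθ : |θ| ≤ lam0 / 4) (Q : Measure (Cov d))
    [IsProbabilityMeasure Q] {f : Cov d → ℝ} (hf : Measurable f) (X : Fin n → Cov d) :
    ∫⁻ e, ∫⁻ x, ENNReal.ofReal (Real.cosh
        (θ * (k * noiseMean k f (fun i => (X i, f (X i) + e i)) x))) ∂Q
        ∂(Measure.pi fun _ : Fin n => ν)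
      ≤ ENNReal.ofReal (Real.exp (k * (2 * sig0 / lam0 ^ 2 * θ ^ 2))) := by
  have := hν.isProb
  have hs := hν.one_le hlam
  have hpair : Measurable fun z : (Fin n → ℝ) × Cov d =>
      ((fun i : Fin n => (X i, f (X i) + z.1 i)), z.2) := by fun_prop
  have hZm := (measurable_noiseMean (n := n) k hf).comp hpair
  have hm : Measurable fun z : (Fin n → ℝ) × Cov d => ENNReal.ofReal (Real.cosh
      (θ * (k * noiseMean k f (fun i => (X i, f (X i) + z.1 i)) z.2))) :=
    (Real.measurable_cosh.comp ((hZm.const_mul _).const_mul _)).ennreal_ofReal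
  refine lintegral_lintegral_le_of_forall (Measure.pi fun _ : Fin n => ν) Q hm fun x => ?_
  obtain ⟨A, hA, he⟩ := mul_noiseMean_eq_sum hk f X x
  simp only [he]
  refine (hν.lintegral_cosh_sum_le hlam hθ A).trans (ENNReal.ofReal_le_ofReal ?_)
  have hA' : (A.card : ℝ) ≤ k := by exact_mod_cast hA
  have h0 : 0 ≤ 2 * sig0 / lam0 ^ 2 * θ ^ 2 := by positivity
  exact Real.exp_le_exp.2 (mul_le_mul_of_nonneg_right hA' h0)

theorem measure_noise_ge_le {d n k : ℕ} (hk : 0 < k) {lam0 sig0 t : ℝ} (hlam : 0 < lam0)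
    (ht : 0 < t) (htl : t * lam0 ≤ sig0) (P Q : Measure (Cov d)) (ν : Measure ℝ)
    [IsProbabilityMeasure P] [IsProbabilityMeasure Q] (hν : IsNoiseLaw lam0 sig0 ν)
    {f : Cov d → ℝ} (hf : Measurable f) :
    Measure.pi (fun _ : Fin n => regressionLaw P f ν)
        {s | ENNReal.ofReal (t ^ 2) ≤ ∫⁻ x, ENNReal.ofReal (noiseMean k f s x ^ 2) ∂Q}
      ≤ ENNReal.ofReal (2 * Real.exp (-(lam0 ^ 2 / (8 * sig0) * k * t ^ 2))) := by
  have := hν.isProb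
  have hs1 := hν.one_le hlam
  have hs0 : 0 < sig0 := by linarith
  have hk0 : (0 : ℝ) < k := by positivity
  -- The minimiser of `2 sig0 k θ² / lam0² - θ k t`; `htl` keeps it within the range of the moment
  -- bound.
  set θ := t * lam0 ^ 2 / (4 * sig0) with hθ
  have hθ0 : 0 < θ := by positivity
  have hθl : |θ| ≤ lam0 / 4 := by
    rw [abs_of_pos hθ0, hθ, div_le_div_iff₀ (by positivity) (by norm_num)]
    nlinarith
  set b := θ * k * t with hb
  have hb0 : 0 < b := by positivity
  have hZm := measurable_noiseMean (n := n) k hf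
  have hsec : ∀ s, Measurable fun x => noiseMean (n := n) k f s x := fun s =>
    hZm.comp measurable_prodMk_left
  set G : (Fin n → Cov d × ℝ) → ℝ≥0∞ :=
    fun s => ∫⁻ x, ENNReal.ofReal (Real.cosh (θ * (k * noiseMean k f s x))) ∂Q with hG
  have hcm : Measurable fun z : (Fin n → Cov d × ℝ) × Cov d =>
      ENNReal.ofReal (Real.cosh (θ * (k * noiseMean k f z.1 z.2))) :=
    (Real.measurable_cosh.comp ((hZm.const_mul _).const_mul _)).ennreal_ofReal
  have hGm : Measurable G := hcm.lintegral_prod_right'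
  have hsub : {s : Fin n → Cov d × ℝ |
      ENNReal.ofReal (t ^ 2) ≤ ∫⁻ x, ENNReal.ofReal (noiseMean k f s x ^ 2) ∂Q}
      ⊆ {s | ENNReal.ofReal (Real.cosh b) ≤ G s} := fun s hs => by
    simp only [Set.mem_ofPred_eq] at hs ⊢
    refine cosh_le_lintegral_cosh Q (((hsec s).const_mul _).const_mul _) hb0 ?_
    have e1 : b ^ 2 = (θ * k) ^ 2 * t ^ 2 := by ring
    have e2 : ∀ x, (θ * (k * noiseMean k f s x)) ^ 2 = (θ * k) ^ 2 * noiseMean k f s x ^ 2 :=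
      fun x => by ring
    simp_rw [e1, e2, ENNReal.ofReal_mul (sq_nonneg (θ * (k : ℝ)))]
    rw [lintegral_const_mul _ ((hsec s).pow_const 2).ennreal_ofReal]
    gcongr
  have hmean : ∫⁻ s, G s ∂(Measure.pi fun _ : Fin n => regressionLaw P f ν)
      ≤ ENNReal.ofReal (Real.exp (k * (2 * sig0 / lam0 ^ 2 * θ ^ 2))) := by
    have hΦ : Measurable fun (z : (Fin n → Cov d) × (Fin n → ℝ)) (i : Fin n) =>
        (z.1 i, f (z.1 i) + z.2 i) := by fun_prop
    rw [pi_regressionLaw_eq_map P ν hf, lintegral_map hGm hΦ,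
      lintegral_prod (fun z : (Fin n → Cov d) × (Fin n → ℝ) => G fun i =>
        (z.1 i, f (z.1 i) + z.2 i)) (hGm.comp hΦ).aemeasurable]
    exact (lintegral_mono fun X => lintegral_cosh_noiseMean_le hk hlam hν hθl Q hf X).trans
      (by simp)
  calc _ ≤ _ := measure_mono hsub
    _ ≤ (∫⁻ s, G s ∂(Measure.pi fun _ : Fin n => regressionLaw P f ν))
        / ENNReal.ofReal (Real.cosh b) :=
        meas_ge_le_lintegral_div hGm.aemeasurable (by simp [Real.cosh_pos]) ENNReal.ofReal_ne_top
    _ ≤ ENNReal.ofReal (Real.exp (k * (2 * sig0 / lam0 ^ 2 * θ ^ 2)))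
        / ENNReal.ofReal (Real.exp b / 2) := by
        gcongr
        rw [Real.cosh_eq]
        linarith [Real.exp_pos (-b)]
    _ = _ := by
        rw [← ENNReal.ofReal_div_of_pos (by positivity)]
        congr 1
        rw [div_div_eq_mul_div, mul_comm, mul_div_assoc, ← Real.exp_sub]
        congr 2
        rw [hb, hθ]
        field_simp
        ring

/-! ### Points with a sparse neighbourhood -/

/-- The points `x` of `G` with fewer than `k` sample points at distance at most `t x`. -/
def sparseSet {d n : ℕ} (k : ℕ) (G : Set (Cov d)) (t : Cov d → ℝ) (s : Fin n → Cov d × ℝ) :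
    Set (Cov d) :=
  {x | x ∈ G ∧ (Finset.univ.filter fun i => ‖x - (s i).1‖ ≤ t x).card < k}

theorem measurableSet_sparseSet {d n : ℕ} (k : ℕ) {G : Set (Cov d)} (hG : MeasurableSet G)
    {t : Cov d → ℝ} (ht : Measurable t) :
    MeasurableSet {z : (Fin n → Cov d × ℝ) × Cov d | z.2 ∈ sparseSet k G t z.1} := by
  refine (measurable_snd hG).inter (measurableSet_lt (f := fun z : (Fin n → Cov d × ℝ) × Cov d =>
    (Finset.univ.filter fun i => ‖z.2 - (z.1 i).1‖ ≤ t z.2).card) ?_ measurable_const)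
  simp_rw [Finset.card_filter]
  refine Finset.measurable_sum _ fun i _ => Measurable.ite ?_ measurable_const measurable_const
  exact measurableSet_le (by fun_prop) (by fun_prop)

/-- By Tonelli the expected `Q`-mass of the sparse set is an average over `x` of binomial lower
tails, each at most `e^(-k)`. -/
theorem measure_sparseSet_ge_le {d n k : ℕ} (hn : 0 < n) (P Q : Measure (Cov d)) (ν : Measure ℝ)
    [IsProbabilityMeasure P] [IsProbabilityMeasure Q] [IsProbabilityMeasure ν]
    {f : Cov d → ℝ} (hf : Measurable f) {G : Set (Cov d)} (hG : MeasurableSet G)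
    {t : Cov d → ℝ} (ht : Measurable t)
    (hP : ∀ x ∈ G, ENNReal.ofReal (4 * k / n) ≤ P (Metric.closedBall x (t x)))
    {c : ℝ} (hc : 0 < c) :
    Measure.pi (fun _ : Fin n => regressionLaw P f ν)
        {s | ENNReal.ofReal (Real.exp (-k) * c) ≤ Q (sparseSet k G t s)}
      ≤ ENNReal.ofReal c⁻¹ := by
  classical
  have : Fact (Measurable f) := ⟨hf⟩
  set W := Measure.pi (fun _ : Fin n => regressionLaw P f ν)
  have hM := measurableSet_sparseSet (n := n) k hG ht
  have hmean : ∫⁻ s, Q (sparseSet k G t s) ∂W ≤ ENNReal.ofReal (Real.exp (-k)) := by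
    have h1 := Measure.prod_apply (μ := W) (ν := Q) hM
    have h2 := Measure.prod_apply_symm (μ := W) (ν := Q) hM
    have h3 : ∫⁻ s, Q (sparseSet k G t s) ∂W
        = ∫⁻ x, W {s | x ∈ sparseSet k G t s} ∂Q := h1.symm.trans h2
    rw [h3]
    have hx : ∀ x, W {s | x ∈ sparseSet k G t s} ≤ ENNReal.ofReal (Real.exp (-k)) := fun x => by
      by_cases hxG : x ∈ G
      · have hB : MeasurableSet (Prod.fst ⁻¹' Metric.closedBall x (t x) : Set (Cov d × ℝ)) :=
          measurable_fst Metric.isClosed_closedBall.measurableSet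
        refine (measure_mono fun s hs => ?_).trans
          (measure_card_lt_le (regressionLaw P f ν) hB hn (k := k) ?_)
        · have hs' := hs.2
          simp only [Set.mem_ofPred_eq]
          refine lt_of_le_of_lt (le_of_eq ?_) hs'
          congr 1
          ext i
          simp [dist_eq_norm, norm_sub_rev]
        · rw [regressionLaw_preimage_fst P ν hf Metric.isClosed_closedBall.measurableSet]
          exact hP x hxG
      · have : {s : Fin n → Cov d × ℝ | x ∈ sparseSet k G t s} = ∅ := by
          ext s
          simp [sparseSet, hxG]
        rw [this]
        simp
    exact (lintegral_mono hx).trans (by simp)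
  have hmeas : Measurable fun s => Q (sparseSet (n := n) k G t s) :=
    measurable_measure_prodMk_left hM
  calc _ ≤ (∫⁻ s, Q (sparseSet k G t s) ∂W) / ENNReal.ofReal (Real.exp (-k) * c) :=
        meas_ge_le_lintegral_div hmeas.aemeasurable
          (by simpa using mul_pos (Real.exp_pos _) hc) ENNReal.ofReal_ne_top
    _ ≤ ENNReal.ofReal (Real.exp (-k)) / ENNReal.ofReal (Real.exp (-k) * c) := by gcongr
    _ = _ := by
        rw [← ENNReal.ofReal_div_of_pos (mul_pos (Real.exp_pos _) hc)]
        congr 1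
        have := Real.exp_pos (-(k : ℝ))
        field_simp

/-! ### The bias term -/

theorem InHolderBall.continuous {d : ℕ} {β F L : ℝ} {f : Cov d → ℝ} (hβ : 0 < β)
    (h : InHolderBall β F L f) : Continuous f := by
  rw [continuous_iff_continuousAt]
  intro x
  rw [ContinuousAt, tendsto_iff_norm_sub_tendsto_zero]
  have h0 : Filter.Tendsto (fun y => L * ‖y - x‖ ^ β) (nhds x) (nhds 0) := by
    have hc : Continuous fun y : Cov d => L * ‖y - x‖ ^ β :=
      continuous_const.mul (Continuous.rpow_const (by fun_prop) fun _ => Or.inr hβ.le)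
    have := hc.tendsto x
    simpa [Real.zero_rpow hβ.ne'] using this
  exact squeeze_zero (fun _ => norm_nonneg _) (fun y => h.holder y x) h0

theorem abs_knnRegressor_sub_le {d n k : ℕ} (hk : 0 < k) (hkn : k ≤ n)
    (s : Fin n → Cov d × ℝ) (x : Cov d) {c M : ℝ}
    (h : ∀ i : Fin n, (i : ℕ) + 1 ≤ k → |(s (neighbourOrder s x i)).2 - c| ≤ M) :
    |knnRegressor (fun _ => k) s x - c| ≤ M := by
  have hk0 : (0 : ℝ) < k := by positivity
  have hsum : ∀ a : ℝ, ∑ i : Fin n, (if (i : ℕ) + 1 ≤ k then a else 0) = k * a := fun a => by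
    rw [Fin.sum_univ_eq_sum_range (fun i => if i + 1 ≤ k then a else 0) n, ← Finset.sum_filter,
      Finset.sum_const, nsmul_eq_mul]
    congr 2
    -- Here `k ≤ n` matters: the average really has `k` terms.
    have : (Finset.range n).filter (fun i => i + 1 ≤ k) = Finset.range k := by
      ext i
      simp only [Finset.mem_filter, Finset.mem_range]
      omega
    rw [this, Finset.card_range]
  have e : knnRegressor (fun _ => k) s x - c = (1 / (k : ℝ)) *
      ∑ i : Fin n, if (i : ℕ) + 1 ≤ k then (s (neighbourOrder s x i)).2 - c else 0 := by
    have hs : ∑ i : Fin n, (if (i : ℕ) + 1 ≤ k then (s (neighbourOrder s x i)).2 - c else 0)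
        = (∑ i : Fin n, if (i : ℕ) + 1 ≤ k then (s (neighbourOrder s x i)).2 else 0) - k * c := by
      rw [← hsum c, ← Finset.sum_sub_distrib]
      refine Finset.sum_congr rfl fun i _ => ?_
      split_ifs <;> simp
    rw [hs, knnRegressor, mul_sub]
    congr 1
    field_simp
  rw [e, abs_mul, abs_of_pos (by positivity : (0 : ℝ) < 1 / k)]
  calc _ ≤ 1 / (k : ℝ) * (k * M) := by
        gcongr
        rw [← hsum M]
        refine (Finset.abs_sum_le_sum_abs _ _).trans (Finset.sum_le_sum fun i _ => ?_)
        split_ifs with hi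
        · exact h i hi
        · simp
    _ = M := by field_simp

/-- A sorted distance is at most `t` as soon as its rank is below the number of distances at most
`t`, and sorting does not change that number. -/
theorem norm_sub_neighbour_le {d n k : ℕ} (s : Fin n → Cov d × ℝ) (x : Cov d) {t : ℝ}
    (h : k ≤ (Finset.univ.filter fun i => ‖x - (s i).1‖ ≤ t).card) (i : Fin n)
    (hi : (i : ℕ) + 1 ≤ k) : ‖x - (s (neighbourOrder s x i)).1‖ ≤ t := by
  rw [← Tuple.lt_card_le_iff_apply_le_of_monotone (neighbourOrder_monotone s x)]
  have e : (Finset.univ.filter fun j => ‖x - (s (neighbourOrder s x j)).1‖ ≤ t).card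
      = (Finset.univ.filter fun j => ‖x - (s j).1‖ ≤ t).card := by
    refine Finset.card_bij (fun j _ => neighbourOrder s x j) ?_ ?_ ?_
    · simp
    · simp
    · intro j hj
      exact ⟨(neighbourOrder s x).symm j, by simpa using hj, by simp⟩
  rw [e]
  omega

theorem InHolderBall.abs_signalMean_sub_le {d n k : ℕ} {β F L : ℝ} {f : Cov d → ℝ}
    (h : InHolderBall β F L f) (hk : 0 < k) (hkn : k ≤ n) (s : Fin n → Cov d × ℝ) (x : Cov d) :
    |signalMean k f s x - f x| ≤ 2 * F := by
  refine abs_knnRegressor_sub_le hk hkn _ x fun i _ => ?_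
  refine (abs_sub _ _).trans ?_
  linarith [h.bound (s (neighbourOrder (fun i => ((s i).1, f (s i).1)) x i)).1, h.bound x]

theorem InHolderBall.abs_signalMean_sub_le_of_card {d n k : ℕ} {β F L t : ℝ} {f : Cov d → ℝ}
    (h : InHolderBall β F L f) (hβ : 0 < β) (hL : 0 < L) (hk : 0 < k) (hkn : k ≤ n)
    (s : Fin n → Cov d × ℝ) (x : Cov d)
    (hc : k ≤ (Finset.univ.filter fun i => ‖x - (s i).1‖ ≤ t).card) :
    |signalMean k f s x - f x| ≤ L * t ^ β := by
  refine abs_knnRegressor_sub_le hk hkn _ x fun i hi => ?_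
  have h1 := norm_sub_neighbour_le s x hc i hi
  have h2 := h.holder (s (neighbourOrder s x i)).1 x
  rw [norm_sub_rev] at h2
  refine h2.trans ?_
  gcongr

/-- The points of positive density `p` whose ball of radius `rm` has mass at least `m`, according
to the minimal mass property. -/
def denseSet {d : ℕ} (p : Cov d → ℝ) (am rm m : ℝ) : Set (Cov d) :=
  {x | 0 < p x ∧ m ≤ am * p x * rm ^ d}

/-- The radius at which the minimal mass property guarantees a ball of mass `m`. -/
noncomputable def massRadius {d : ℕ} (p : Cov d → ℝ) (am rm m : ℝ) (x : Cov d) : ℝ :=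
  rm * (m / (am * p x * rm ^ d)) ^ (1 / (d : ℝ))

theorem measurableSet_denseSet {d : ℕ} {p : Cov d → ℝ} (hp : Measurable p) (am rm m : ℝ) :
    MeasurableSet (denseSet p am rm m) :=
  (measurableSet_lt measurable_const hp).inter
    (measurableSet_le measurable_const ((hp.const_mul am).mul_const (rm ^ d)))

theorem measurable_massRadius {d : ℕ} {p : Cov d → ℝ} (hp : Measurable p) (am rm m : ℝ) :
    Measurable (massRadius p am rm m) := by
  unfold massRadius
  fun_prop

/-- The radius solves `am * p x * t ^ d = m`, and membership in `denseSet` gives `t ≤ rm`. -/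
theorem InMassClass.ofReal_le_measure_massRadius {d : ℕ} (hd : 1 ≤ d)
    {pbar am rm ap rp m : ℝ} {P : Measure (Cov d)} {p : Cov d → ℝ}
    (h : InMassClass pbar am rm ap rp P p) (ham : 0 < am) (hrm : 0 < rm) (hm : 0 < m)
    {x : Cov d} (hx : x ∈ denseSet p am rm m) :
    ENNReal.ofReal m ≤ P (Metric.closedBall x (massRadius p am rm m x)) := by
  obtain ⟨hpx, hle⟩ := hx
  have hd0 : (d : ℝ) ≠ 0 := by positivity
  have hw0 : 0 < m / (am * p x * rm ^ d) := by positivity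
  have hw1 : m / (am * p x * rm ^ d) ≤ 1 := (div_le_one (by positivity)).2 hle
  have ht : am * p x * massRadius p am rm m x ^ d = m := by
    rw [massRadius, mul_pow, ← Real.rpow_natCast (_ ^ (1 / (d : ℝ))), ← Real.rpow_mul hw0.le,
      one_div_mul_cancel hd0, Real.rpow_one]
    field_simp
  have := h.minimalMass x (massRadius p am rm m x) (mul_pos hrm (Real.rpow_pos_of_pos hw0 _))
    (mul_le_of_le_one_right hrm.le (Real.rpow_le_one hw0.le hw1 (by positivity)))
  rwa [ht] at this

theorem momentExponent_pos {d : ℕ} (hd : 1 ≤ d) {β γ : ℝ} (hβ : 0 < β) (hγ : 0 < γ) :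
    0 < momentExponent d β γ :=
  lt_min (by positivity) hγ

/-- With `w = m / (am p(x) rm^d)`, both regimes are bounded by `w ^ u`: if `w ≤ 1`, Hölder gives `w
^ (2β/d) ≤ w ^ u`; if `w > 1`, the trivial bound suffices because `w ^ u ≥ 1`. Where `p x = 0` the
right side is infinite. -/
theorem InHolderBall.ofReal_bias_le {d n k : ℕ} (hd : 1 ≤ d) {β γ F L am rm m : ℝ}
    {f p : Cov d → ℝ} (h : InHolderBall β F L f) (hβ : 0 < β) (hγ : 0 < γ) (hF : 0 < F)
    (hL : 0 < L) (ham : 0 < am) (hrm : 0 < rm) (hm : 0 < m) (hk : 0 < k) (hkn : k ≤ n)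
    (hp : ∀ x, 0 ≤ p x) (s : Fin n → Cov d × ℝ) (x : Cov d)
    (hx : x ∉ sparseSet k (denseSet p am rm m) (massRadius p am rm m) s) :
    ENNReal.ofReal (2 * (signalMean k f s x - f x) ^ 2)
      ≤ ENNReal.ofReal ((2 * L ^ 2 * rm ^ (2 * β) + 8 * F ^ 2)
          * (m / (am * rm ^ d)) ^ momentExponent d β γ)
        * (ENNReal.ofReal (p x) ^ momentExponent d β γ)⁻¹ := by
  have hu := momentExponent_pos hd hβ hγ
  have hd0 : (0 : ℝ) < d := by positivity
  set u := momentExponent d β γ with hudef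
  have hA : 0 < 2 * L ^ 2 * rm ^ (2 * β) := by positivity
  rcases (hp x).eq_or_lt with hpx | hpx
  · rw [← hpx, ENNReal.ofReal_zero, ENNReal.zero_rpow_of_pos hu, ENNReal.inv_zero,
      ENNReal.mul_top]
    · exact le_top
    · rw [← pos_iff_ne_zero, ENNReal.ofReal_pos]
      positivity
  · rw [ENNReal.ofReal_rpow_of_pos hpx, ← ENNReal.ofReal_inv_of_pos (by positivity),
      ← ENNReal.ofReal_mul (by positivity)]
    apply ENNReal.ofReal_le_ofReal
    set w := m / (am * p x * rm ^ d) with hw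
    have hw0 : 0 < w := by positivity
    have e : (m / (am * rm ^ d)) ^ u * (p x ^ u)⁻¹ = w ^ u := by
      rw [← Real.inv_rpow hpx.le, ← Real.mul_rpow (by positivity) (by positivity), hw]
      congr 1
      field_simp
    rw [mul_assoc, e]
    by_cases hle : m ≤ am * p x * rm ^ d
    · have hc : k ≤ (Finset.univ.filter fun i => ‖x - (s i).1‖ ≤ massRadius p am rm m x).card := by
        by_contra hcon
        exact hx ⟨⟨hpx, hle⟩, not_le.1 hcon⟩
      have hb := h.abs_signalMean_sub_le_of_card hβ hL hk hkn s x hc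
      have hw1 : w ≤ 1 := (div_le_one (by positivity)).2 hle
      have hr0 : 0 ≤ massRadius p am rm m x := mul_nonneg hrm.le (Real.rpow_nonneg hw0.le _)
      have hsq : (signalMean k f s x - f x) ^ 2 ≤ (L * massRadius p am rm m x ^ β) ^ 2 := by
        rw [← sq_abs]
        gcongr
      have e2 : (L * massRadius p am rm m x ^ β) ^ 2
          = L ^ 2 * rm ^ (2 * β) * w ^ (2 * β / d) := by
        rw [mul_pow, ← Real.rpow_natCast (massRadius p am rm m x ^ β), ← Real.rpow_mul hr0,
          massRadius, Real.mul_rpow hrm.le (Real.rpow_nonneg hw0.le _), ← Real.rpow_mul hw0.le]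
        have e3 : 1 / (d : ℝ) * (β * (2 : ℕ)) = 2 * β / d := by push_cast; ring
        have e4 : β * (2 : ℕ) = 2 * β := by push_cast; ring
        rw [e3, e4, mul_assoc]
      have hwu : w ^ (2 * β / d) ≤ w ^ u :=
        Real.rpow_le_rpow_of_exponent_ge hw0 hw1 (min_le_left _ _)
      calc 2 * (signalMean k f s x - f x) ^ 2
          ≤ 2 * (L ^ 2 * rm ^ (2 * β) * w ^ u) := by
            rw [e2] at hsq
            have : L ^ 2 * rm ^ (2 * β) * w ^ (2 * β / d) ≤ L ^ 2 * rm ^ (2 * β) * w ^ u := by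
              gcongr
            linarith
        _ ≤ _ := by
            have : 0 ≤ 8 * F ^ 2 * w ^ u := by positivity
            nlinarith
    · have hw1 : 1 ≤ w := (one_le_div (by positivity)).2 (not_le.1 hle).le
      have hwu : 1 ≤ w ^ u := Real.one_le_rpow hw1 hu.le
      have hb := h.abs_signalMean_sub_le hk hkn s x
      have hsq : (signalMean k f s x - f x) ^ 2 ≤ (2 * F) ^ 2 := by
        rw [← sq_abs]
        gcongr
      calc 2 * (signalMean k f s x - f x) ^ 2 ≤ (2 * L ^ 2 * rm ^ (2 * β) + 8 * F ^ 2) * 1 := by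
            linarith
        _ ≤ _ := by gcongr

theorem HasBoundedDensity.lintegral_inv_rpow {d : ℕ} {pbar : ℝ} {Q : Measure (Cov d)}
    {p q : Cov d → ℝ} (h : HasBoundedDensity pbar Q q) (hp : Measurable p) (t : ℝ) :
    ∫⁻ x, (ENNReal.ofReal (p x) ^ t)⁻¹ ∂Q = densityRatioMoment p q t := by
  rw [h.eq_withDensity, lintegral_withDensity_eq_lintegral_mul _ h.measurable.ennreal_ofReal
    (by fun_prop)]
  rfl

/-- The risk on samples for which the noise term is small and few points are sparse. -/
theorem l2Risk_knnRegressor_le {d n k : ℕ} (hd : 1 ≤ d) {β γ F L am rm m qbar : ℝ}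
    {f p q : Cov d → ℝ} (h : InHolderBall β F L f) (hβ : 0 < β) (hγ : 0 < γ) (hF : 0 < F)
    (hL : 0 < L) (ham : 0 < am) (hrm : 0 < rm) (hm : 0 < m) (hk : 0 < k) (hkn : k ≤ n)
    (hp : ∀ x, 0 ≤ p x) (hpm : Measurable p) {Q : Measure (Cov d)}
    (hQ : HasBoundedDensity qbar Q q) (s : Fin n → Cov d × ℝ) :
    l2Risk Q (knnRegressor (fun _ => k) s) f
      ≤ 2 * (∫⁻ x, ENNReal.ofReal (noiseMean k f s x ^ 2) ∂Q)
        + (ENNReal.ofReal ((2 * L ^ 2 * rm ^ (2 * β) + 8 * F ^ 2)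
            * (m / (am * rm ^ d)) ^ momentExponent d β γ)
          * densityRatioMoment p q (momentExponent d β γ)
        + ENNReal.ofReal (8 * F ^ 2)
          * Q (sparseSet k (denseSet p am rm m) (massRadius p am rm m) s)) := by
  have hfm := (h.continuous hβ).measurable
  set u := momentExponent d β γ with hu
  set E := sparseSet k (denseSet p am rm m) (massRadius p am rm m) s
  have hE : MeasurableSet E :=
    (measurableSet_sparseSet (n := n) k (measurableSet_denseSet hpm am rm m)
      (measurable_massRadius hpm am rm m)).preimage measurable_prodMk_left
  have hZ : Measurable fun x => ENNReal.ofReal (noiseMean k f s x ^ 2) :=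
    (((measurable_noiseMean (n := n) k hfm).comp measurable_prodMk_left).pow_const 2).ennreal_ofReal
  set A := ENNReal.ofReal ((2 * L ^ 2 * rm ^ (2 * β) + 8 * F ^ 2) * (m / (am * rm ^ d)) ^ u)
  rw [← hQ.lintegral_inv_rpow hpm, l2Risk]
  calc _ ≤ ∫⁻ x, (2 * ENNReal.ofReal (noiseMean k f s x ^ 2)
        + (A * (ENNReal.ofReal (p x) ^ u)⁻¹
          + E.indicator (fun _ => ENNReal.ofReal (8 * F ^ 2)) x)) ∂Q := by
        refine lintegral_mono fun x => ?_
        have h1 : ENNReal.ofReal ((knnRegressor (fun _ => k) s x - f x) ^ 2)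
            ≤ 2 * ENNReal.ofReal (noiseMean k f s x ^ 2)
              + ENNReal.ofReal (2 * (signalMean k f s x - f x) ^ 2) := by
          rw [knnRegressor_eq_add k f, ← ENNReal.ofReal_ofNat, ← ENNReal.ofReal_mul (by norm_num),
            ← ENNReal.ofReal_add (by positivity) (by positivity)]
          apply ENNReal.ofReal_le_ofReal
          nlinarith [sq_nonneg (noiseMean k f s x - (signalMean k f s x - f x))]
        refine h1.trans ?_
        gcongr
        by_cases hx : x ∈ E
        · rw [Set.indicator_of_mem hx]
          refine le_trans ?_ le_add_self
          apply ENNReal.ofReal_le_ofReal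
          have hb := h.abs_signalMean_sub_le hk hkn s x
          have hsq : (signalMean k f s x - f x) ^ 2 ≤ (2 * F) ^ 2 := by
            rw [← sq_abs]
            gcongr
          linarith
        · rw [Set.indicator_of_notMem hx, add_zero]
          exact h.ofReal_bias_le hd hβ hγ hF hL ham hrm hm hk hkn hp s x hx
    _ = _ := by
        rw [lintegral_add_left (by fun_prop), lintegral_const_mul _ hZ,
          lintegral_add_left (by fun_prop), lintegral_const_mul _ (by fun_prop),
          lintegral_indicator_const hE]

/-! ### Moments of the density ratio -/

/-- Almost everywhere `p ^ (-t) = p ^ (γ - t) * p ^ (-γ) ≤ pbar ^ (γ - t) * p ^ (-γ)` where `p > 0`.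
-/
theorem densityRatioMoment_lt_top {d : ℕ} {pbar t γ : ℝ} {P : Measure (Cov d)}
    {p q : Cov d → ℝ} (hP : HasBoundedDensity pbar P p)
    (hpbar : 0 < pbar) (ht : 0 < t) (htγ : t ≤ γ)
    (h : densityRatioMoment p q γ < ∞) : densityRatioMoment p q t < ∞ := by
  have hle : densityRatioMoment p q t
      ≤ ENNReal.ofReal pbar ^ (γ - t) * densityRatioMoment p q γ := by
    rw [densityRatioMoment, densityRatioMoment,
      ← lintegral_const_mul' _ _ (ENNReal.rpow_ne_top_of_nonneg (by linarith)
        ENNReal.ofReal_ne_top)]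
    refine lintegral_mono_ae ?_
    filter_upwards [hP.bound] with x hx
    rcases (hP.nonneg x).eq_or_lt with hpx | hpx
    · by_cases hq : ENNReal.ofReal (q x) = 0
      · simp [hq]
      · rw [← hpx, ENNReal.ofReal_zero, ENNReal.zero_rpow_of_pos (ht.trans_le htγ),
          ENNReal.div_zero hq, ENNReal.mul_top]
        · exact le_top
        · exact (ENNReal.rpow_pos (ENNReal.ofReal_pos.2 hpbar) ENNReal.ofReal_ne_top).ne'
    · rw [div_eq_mul_inv, div_eq_mul_inv, mul_left_comm]
      gcongr
      rw [ENNReal.ofReal_rpow_of_pos hpx, ENNReal.ofReal_rpow_of_pos hpx,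
        ENNReal.ofReal_rpow_of_pos hpbar, ← ENNReal.ofReal_inv_of_pos (by positivity),
        ← ENNReal.ofReal_inv_of_pos (by positivity), ← ENNReal.ofReal_mul (by positivity)]
      apply ENNReal.ofReal_le_ofReal
      have h1 : p x ^ γ = p x ^ (γ - t) * p x ^ t := by
        rw [← Real.rpow_add hpx]
        ring_nf
      have h2 : p x ^ (γ - t) ≤ pbar ^ (γ - t) :=
        Real.rpow_le_rpow hpx.le hx (by linarith)
      have h3 : 0 < p x ^ (γ - t) := Real.rpow_pos_of_pos hpx _
      have h4 : 0 < p x ^ t := Real.rpow_pos_of_pos hpx _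
      rw [h1, mul_inv, ← mul_assoc, ← div_eq_mul_inv]
      exact le_mul_of_one_le_left (by positivity) ((one_le_div h3).2 h2)
  exact hle.trans_lt (ENNReal.mul_lt_top (ENNReal.rpow_lt_top_of_nonneg (by linarith)
    ENNReal.ofReal_ne_top) h)

/-- Total mass one forces `am * p x * rm ^ d ≤ 1`. This lower bound on the moment lets the
sparse-set term, which carries no moment, be absorbed into one that does. -/
theorem InMassClass.rpow_le_densityRatioMoment {d : ℕ} {pbar am rm ap rp qbar t : ℝ}
    {P Q : Measure (Cov d)} {p q : Cov d → ℝ} (hP : InMassClass pbar am rm ap rp P p)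
    (hQ : HasBoundedDensity qbar Q q) (ham : 0 < am) (hrm : 0 < rm) (ht : 0 < t) :
    ENNReal.ofReal ((am * rm ^ d) ^ t) ≤ densityRatioMoment p q t := by
  have := hP.isProb
  have := hQ.isProb
  rw [← hQ.lintegral_inv_rpow hP.measurable]
  have hpt : ∀ x, ENNReal.ofReal ((am * rm ^ d) ^ t) ≤ (ENNReal.ofReal (p x) ^ t)⁻¹ := fun x => by
    have h1 := (hP.minimalMass x rm hrm le_rfl).trans prob_le_one
    rw [ENNReal.ofReal_le_one] at h1
    rw [ENNReal.le_inv_iff_mul_le, ← ENNReal.ofReal_rpow_of_pos (by positivity),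
      ← ENNReal.mul_rpow_of_nonneg _ _ ht.le, ← ENNReal.ofReal_mul (by positivity)]
    refine (ENNReal.rpow_le_rpow (z := t) (ENNReal.ofReal_le_one.2 ?_) ht.le).trans (by simp)
    linarith
  calc _ = ∫⁻ _, ENNReal.ofReal ((am * rm ^ d) ^ t) ∂Q := by simp
    _ ≤ _ := lintegral_mono hpt

/-! ### The number of neighbours -/

/-- Since `a ↦ a / (a + 1)` is increasing it commutes with the minimum, whence `r = u / (u + 1)`. -/
theorem rateExponent_eq {d : ℕ} (hd : 1 ≤ d) {β γ : ℝ} (hβ : 0 < β) (hγ : 0 < γ) :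
    0 < rateExponent d β γ ∧ rateExponent d β γ < 1 ∧
      momentExponent d β γ * (1 - rateExponent d β γ) = rateExponent d β γ := by
  have hd0 : (0 : ℝ) < d := by positivity
  have hu := momentExponent_pos hd hβ hγ
  have e1 : 2 * β / (2 * β + d) = (2 * β / d) / (2 * β / d + 1) := by
    field_simp
  have hmono : ∀ a b : ℝ, 0 < a → a ≤ b → a / (a + 1) ≤ b / (b + 1) := fun a b ha hab => by
    rw [div_le_div_iff₀ (by linarith) (by linarith)]
    nlinarith
  have e2 : rateExponent d β γ = momentExponent d β γ / (momentExponent d β γ + 1) := by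
    rw [rateExponent, momentExponent, e1]
    rcases le_total (2 * β / d) γ with h | h
    · rw [min_eq_left h, min_eq_left (hmono _ _ (by positivity) h)]
    · rw [min_eq_right h, min_eq_right (hmono _ _ hγ h)]
  rw [e2]
  refine ⟨by positivity, (div_lt_one (by linarith)).2 (by linarith), ?_⟩
  field_simp
  ring

theorem log_rpow_mul_rpow {n : ℕ} (hn : 2 ≤ n) (r : ℝ) :
    Real.log n ^ (1 - r) * (n : ℝ) ^ r = Real.log n * ((n : ℝ) / Real.log n) ^ r := by
  have hl : 0 < Real.log n := Real.log_pos (by exact_mod_cast hn)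
  rw [Real.div_rpow (by positivity) hl.le, Real.rpow_sub hl, Real.rpow_one]
  ring

theorem eventually_neighbourCount {r κ τ c δ : ℝ} (hr0 : 0 < r) (hr1 : r < 1) (hκ : 0 < κ)
    (hδ : 0 < δ) :
    ∀ᶠ n : ℕ in Filter.atTop,
      1 ≤ κ * Real.log n ^ (1 - r) * (n : ℝ) ^ r ∧ neighbourCount κ r n ≤ n ∧
      c * Real.log n ≤ neighbourCount κ r n ∧
      Real.exp (-(neighbourCount κ r n : ℕ)) * (n : ℝ) ^ τ ≤ δ * (Real.log n / n) ^ r := by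
  have hlim : Filter.Tendsto (fun n : ℕ => (n : ℝ) / Real.log n) Filter.atTop Filter.atTop := by
    have h1 : Filter.Tendsto (fun x : ℝ => Real.log x / x) Filter.atTop (nhds 0) :=
      Real.isLittleO_log_id_atTop.tendsto_div_nhds_zero
    have h2 : Filter.Tendsto (fun x : ℝ => Real.log x / x) Filter.atTop (nhdsWithin 0 (Set.Ioi 0)) :=
      tendsto_nhdsWithin_iff.2 ⟨h1, by
        filter_upwards [Filter.eventually_gt_atTop 1] with x hx
        exact div_pos (Real.log_pos hx) (by linarith)⟩
    have h3 := h2.inv_tendsto_nhdsGT_zero.comp tendsto_natCast_atTop_atTop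
    refine h3.congr fun n => ?_
    simp
  -- With `l = n / log n`, the unrounded count is `log n * κ l ^ r`. Large `κ l ^ r` gives the lower
  -- bounds on it; large `l ^ (1 - r)` gives `k ≤ n` and the factor `δ`.
  have ha := ((tendsto_rpow_atTop hr0).comp hlim).eventually_ge_atTop
    (max 1 (max c (τ + 1)) / κ)
  have hb := ((tendsto_rpow_atTop (sub_pos.2 hr1)).comp hlim).eventually_ge_atTop
    (max (2 * κ) (1 / δ))
  filter_upwards [ha, hb, Filter.eventually_ge_atTop 3] with n ha hb hn
  simp only [Function.comp_apply] at ha hb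
  have hn0 : (0 : ℝ) < n := by positivity
  have hl1 : 1 ≤ Real.log n := by
    rw [Real.le_log_iff_exp_le hn0]
    exact Real.exp_one_lt_three.le.trans (by exact_mod_cast hn)
  have hl0 : 0 < Real.log n := by linarith
  set l := (n : ℝ) / Real.log n with hl
  have hlpos : 0 < l := by positivity
  have hnl : (n : ℝ) = Real.log n * l := by
    rw [hl]
    field_simp
  have hlr : 0 < l ^ r := Real.rpow_pos_of_pos hlpos r
  rw [div_le_iff₀' hκ] at ha
  have ha1 := (le_max_left _ _).trans ha
  have ha2 := ((le_max_left _ _).trans (le_max_right _ _)).trans ha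
  have ha3 := ((le_max_right _ _).trans (le_max_right _ _)).trans ha
  have hb1 := (le_max_left _ _).trans hb
  have hb2 := (le_max_right _ _).trans hb
  have hK : κ * Real.log n ^ (1 - r) * (n : ℝ) ^ r = Real.log n * (κ * l ^ r) := by
    rw [mul_assoc, log_rpow_mul_rpow (by omega)]
    ring
  have hone : 1 ≤ Real.log n * (κ * l ^ r) := one_le_mul_of_one_le_of_one_le hl1 ha1
  have hkle : Real.log n * (κ * l ^ r) ≤ (neighbourCount κ r n : ℕ) := by
    rw [← hK]
    exact Nat.le_ceil _
  have hsplit : l = l ^ r * l ^ (1 - r) := by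
    rw [← Real.rpow_add hlpos]
    simp
  refine ⟨by rwa [hK], ?_, ?_, ?_⟩
  · have h1 : ((neighbourCount κ r n : ℕ) : ℝ) < Real.log n * (κ * l ^ r) + 1 := by
      rw [← hK]
      exact Nat.ceil_lt_add_one (by rw [hK]; linarith)
    have h2 : Real.log n * (κ * l ^ r) * 2 ≤ n := by
      calc Real.log n * (κ * l ^ r) * 2 = Real.log n * (l ^ r * (2 * κ)) := by ring
        _ ≤ Real.log n * (l ^ r * l ^ (1 - r)) := by gcongr
        _ = n := by rw [← hsplit, ← hnl]
    have h3 : ((neighbourCount κ r n : ℕ) : ℝ) ≤ n := by linarith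
    exact_mod_cast h3
  · refine le_trans ?_ hkle
    rw [mul_comm]
    gcongr
  · have h1 : Real.exp (-(neighbourCount κ r n : ℕ)) * (n : ℝ) ^ τ ≤ (n : ℝ)⁻¹ := by
      rw [Real.rpow_def_of_pos hn0, ← Real.exp_add]
      calc _ ≤ Real.exp (-Real.log n) := by
            apply Real.exp_le_exp.2
            have : Real.log n * (τ + 1) ≤ Real.log n * (κ * l ^ r) := by gcongr
            linarith
        _ = _ := by rw [Real.exp_neg, Real.exp_log hn0]
    refine h1.trans ?_
    have e : Real.log n / n = l⁻¹ := by
      rw [hl, inv_div]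
    rw [e, Real.inv_rpow hlpos.le]
    have h2 : (n : ℝ)⁻¹ ≤ l⁻¹ := by
      apply inv_anti₀ hlpos
      rw [hnl]
      exact le_mul_of_one_le_left hlpos.le hl1
    refine h2.trans ?_
    rw [← div_eq_mul_inv, le_div_iff₀ hlr, inv_mul_eq_div, div_le_iff₀ hlpos]
    rw [div_le_iff₀ hδ] at hb2
    calc l ^ r = l ^ r * 1 := by ring
      _ ≤ l ^ r * (l ^ (1 - r) * δ) := by gcongr
      _ = δ * (l ^ r * l ^ (1 - r)) := by ring
      _ = δ * l := by rw [← hsplit]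

/-! ### The constants -/

theorem log_permConst_nonneg (d : ℕ) : 0 ≤ Real.log (permConst d) :=
  Real.log_nonneg (le_max_left _ _)

theorem le_massConst {d : ℕ} (hd : 1 ≤ d) {K τ : ℝ} (hK : 1 ≤ K) (hτ : 0 < τ) :
    13 ≤ massConst d K τ := by
  have hd1 : (1 : ℝ) ≤ d := by exact_mod_cast hd
  have hc : 1 ≤ coverConst d K := by
    have h1 : 1 ≤ 2 * K * (2 * d + 1) := by nlinarith
    have h2 : 1 ≤ (4 * Real.exp 1) ^ (2 * d + 1) :=
      one_le_pow₀ (by linarith [Real.add_one_le_exp 1])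
    exact one_le_mul_of_one_le_of_one_le h1 h2
  have hlog : 0 ≤ Real.log (coverConst d K) / Real.log (2 * d) :=
    div_nonneg (Real.log_nonneg hc) (Real.log_nonneg (by linarith))
  rw [massConst, deviationConst]
  set a := 2 * d + τ + Real.log (coverConst d K) / Real.log (2 * d) with ha
  -- Thus `(8a + 24)/3 ≥ 40/3`; what matters later is that `13` exceeds `8`.
  have ha2 : 2 ≤ a := by linarith
  have e : 2 / (1 - (4 * a + 9) / (4 * a + 12)) = (8 * a + 24) / 3 := by
    have : 4 * a + 12 ≠ 0 := by linarith
    rw [one_sub_div this]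
    field_simp
    ring
  rw [e]
  linarith

theorem risk_terms_le {d n k : ℕ} (hd : 1 ≤ d) (hn : 3 ≤ n) (hk : 0 < k)
    {β γ F L am rm lam0 sig0 κ τ K T c E : ℝ} (hβ : 0 < β) (hγ : 0 < γ)
    (hκ : 0 < κ) (hτ : 0 < τ) (ham : 0 < am) (hrm : 0 < rm) (hlam : 0 < lam0) (hsig : 0 < sig0)
    (hK : 1 ≤ K) (hc : c = Real.log (permConst d) + 2 * d + τ + 1)
    (hkl : κ * Real.log n ^ (1 - rateExponent d β γ) * (n : ℝ) ^ rateExponent d β γ ≤ k)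
    (hku : (k : ℝ) ≤ 2 * (κ * Real.log n ^ (1 - rateExponent d β γ)
      * (n : ℝ) ^ rateExponent d β γ))
    (hT : (am * rm ^ d) ^ momentExponent d β γ ≤ T)
    (hE : E ≤ ((13 * κ) ^ momentExponent d β γ - (8 * κ) ^ momentExponent d β γ)
      * (Real.log n / n) ^ rateExponent d β γ) :
    2 * (c * Real.log n / (lam0 ^ 2 / (8 * sig0) * k))
      + ((2 * L ^ 2 * rm ^ (2 * β) + 8 * F ^ 2)
          * (4 * k / n / (am * rm ^ d)) ^ momentExponent d β γ * T + 8 * F ^ 2 * E)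
      ≤ riskConst d β γ F L am rm lam0 sig0 κ τ K T
        * (Real.log n / n) ^ rateExponent d β γ := by
  obtain ⟨hr0, hr1, hur⟩ := rateExponent_eq hd hβ hγ
  have hu := momentExponent_pos hd hβ hγ
  have hB := le_massConst hd hK hτ
  have hperm := log_permConst_nonneg d
  rw [riskConst]
  set r := rateExponent d β γ
  set u := momentExponent d β γ
  set B := massConst d K τ
  have hn0 : (0 : ℝ) < n := by positivity
  have hl0 : 0 < Real.log n := Real.log_pos (by exact_mod_cast (by omega : 1 < n))
  have hk0 : (0 : ℝ) < k := by positivity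
  set G := (Real.log n / n) ^ r with hG
  have hG0 : 0 < G := by positivity
  have hc0 : 0 < c := by rw [hc]; positivity
  have hD : 0 < am * rm ^ d := by positivity
  set D := (am * rm ^ d) ^ u with hDdef
  have hD0 : 0 < D := by positivity
  -- the variance
  have hvar : 2 * (c * Real.log n / (lam0 ^ 2 / (8 * sig0) * k))
      ≤ 2 * varConst d lam0 sig0 τ / κ * G := by
    have h1 : Real.log n / k ≤ G / κ := by
      rw [div_le_div_iff₀ hk0 hκ]
      have e : Real.log n * κ = G * (κ * Real.log n ^ (1 - r) * (n : ℝ) ^ r) := by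
        rw [hG, Real.div_rpow hl0.le hn0.le, Real.rpow_sub hl0, Real.rpow_one]
        field_simp
      rw [e]
      gcongr
    have e2 : 2 * (c * Real.log n / (lam0 ^ 2 / (8 * sig0) * k))
        = 2 * (c / (lam0 ^ 2 / (8 * sig0))) * (Real.log n / k) := by
      field_simp
    rw [e2, varConst, ← hc]
    calc _ ≤ 2 * (c / (lam0 ^ 2 / (8 * sig0))) * (G / κ) := by gcongr
      _ = _ := by ring
  -- the mass of the neighbourhoods
  have hmass : (4 * k / n / (am * rm ^ d)) ^ u ≤ (8 * κ) ^ u * G / D := by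
    rw [Real.div_rpow (by positivity) hD.le]
    gcongr
    have h1 : 4 * (k : ℝ) / n ≤ 8 * κ * (Real.log n / n) ^ (1 - r) := by
      rw [div_le_iff₀ hn0]
      have e : 8 * κ * (Real.log n / n) ^ (1 - r) * n
          = 4 * (2 * (κ * Real.log n ^ (1 - r) * (n : ℝ) ^ r)) := by
        rw [Real.div_rpow hl0.le hn0.le, Real.rpow_sub hn0, Real.rpow_one]
        field_simp
        ring
      rw [e]
      linarith
    calc _ ≤ (8 * κ * (Real.log n / n) ^ (1 - r)) ^ u := by gcongr
      _ = _ := by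
        rw [Real.mul_rpow (by positivity) (by positivity), ← Real.rpow_mul (by positivity),
          mul_comm (1 - r) u, hur]
  -- Multiplying the sparse term by `T / D` gives it the form of the bias term; then `δ + (8κ)^u =
  -- (13κ)^u`.
  have hTD : 1 ≤ T / D := (one_le_div hD0).2 hT
  have hT0 : 0 < T := hD0.trans_le hT
  set δ := (13 * κ) ^ u - (8 * κ) ^ u with hδ
  have hδ0 : 0 ≤ δ := sub_nonneg.2 (Real.rpow_le_rpow (by positivity) (by linarith) hu.le)
  have hE' : 8 * F ^ 2 * E ≤ (2 * L ^ 2 * rm ^ (2 * β) + 8 * F ^ 2) * (δ * G * (T / D)) := by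
    calc 8 * F ^ 2 * E ≤ 8 * F ^ 2 * (δ * G) := by gcongr
      _ ≤ 8 * F ^ 2 * (δ * G * (T / D)) :=
        mul_le_mul_of_nonneg_left (le_mul_of_one_le_right (by positivity) hTD) (by positivity)
      _ ≤ _ := by
        gcongr
        have : 0 ≤ 2 * L ^ 2 * rm ^ (2 * β) := by positivity
        linarith
  have hmass' : (2 * L ^ 2 * rm ^ (2 * β) + 8 * F ^ 2) * (4 * k / n / (am * rm ^ d)) ^ u * T
      ≤ (2 * L ^ 2 * rm ^ (2 * β) + 8 * F ^ 2) * ((8 * κ) ^ u * G * (T / D)) := by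
    calc _ ≤ (2 * L ^ 2 * rm ^ (2 * β) + 8 * F ^ 2) * ((8 * κ) ^ u * G / D) * T := by gcongr
      _ = _ := by ring
  have hBu : (13 * κ) ^ u / D ≤ (κ * B / (am * rm ^ d)) ^ u := by
    rw [hDdef, ← Real.div_rpow (by positivity) hD.le]
    apply Real.rpow_le_rpow (by positivity) _ hu.le
    refine div_le_div_of_nonneg_right ?_ hD.le
    rw [mul_comm]
    gcongr
  calc _ ≤ 2 * varConst d lam0 sig0 τ / κ * G
        + ((2 * L ^ 2 * rm ^ (2 * β) + 8 * F ^ 2) * ((8 * κ) ^ u * G * (T / D))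
          + (2 * L ^ 2 * rm ^ (2 * β) + 8 * F ^ 2) * (δ * G * (T / D))) := by gcongr
    _ = 2 * varConst d lam0 sig0 τ / κ * G
        + (2 * L ^ 2 * rm ^ (2 * β) + 8 * F ^ 2) * ((13 * κ) ^ u / D) * T * G := by
        rw [hδ]
        ring
    _ ≤ 2 * varConst d lam0 sig0 τ / κ * G
        + (2 * L ^ 2 * rm ^ (2 * β) + 8 * F ^ 2) * (κ * B / (am * rm ^ d)) ^ u * T * G := by
        gcongr
    _ = _ := by ring

end CovShift

theorem mainTheorem3 (d : ℕ) (hd : 1 ≤ d) (β γ κ τ : ℝ) (hβ0 : 0 < β) (hβ1 : β ≤ 1)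
    (hγ : 0 < γ) (hκ : 0 < κ) (hτ : 0 < τ) :
    ∃ N : ℕ, 2 * d ≤ N ∧ 3 ≤ N ∧
      ∀ n : ℕ, N ≤ n →
        -- the number of neighbours is admissible
        (1 ≤ CovShift.neighbourCount κ (CovShift.rateExponent d β γ) n ∧
          CovShift.neighbourCount κ (CovShift.rateExponent d β γ) n ≤ n) ∧
        ∀ (F L lam0 sig0 pbar am rm ap rp ρ K : ℝ),
          0 < F → 0 < L → 0 < lam0 → 0 < sig0 → 0 < pbar → 0 < am → 0 < rm → 0 < ap → 0 < rp →
          0 < ρ → 1 ≤ K →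
        ∀ (P Q : Measure (CovShift.Cov d)) (p q : CovShift.Cov d → ℝ),
          CovShift.InMassClass pbar am rm ap rp P p →
          CovShift.InTargetClass pbar am rm ap rp γ ρ p Q q →
        ∀ (f : CovShift.Cov d → ℝ) (ν : Measure ℝ),
          CovShift.InHolderBall β F L f →
          CovShift.IsNoiseLaw lam0 sig0 ν →
        ∀ (Ω : Type*) [MeasurableSpace Ω] (μ : Measure Ω) [IsProbabilityMeasure μ]
          (S : Fin n → Ω → CovShift.Cov d × ℝ),
          (∀ i, HasLaw (S i) (CovShift.regressionLaw P f ν) μ) →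
          iIndepFun S μ →
          -- the bound fails with probability at most `2 n^(-τ)`
          μ {ω | ¬ CovShift.l2Risk Q
                (CovShift.knnRegressor
                  (fun _ => CovShift.neighbourCount κ (CovShift.rateExponent d β γ) n)
                  (fun i => S i ω)) f
              ≤ ENNReal.ofReal
                (CovShift.riskConst d β γ F L am rm lam0 sig0 κ τ K
                    (CovShift.densityRatioMoment p q (CovShift.momentExponent d β γ)).toReal *
                  (Real.log n / n) ^ CovShift.rateExponent d β γ)}
            ≤ ENNReal.ofReal (2 * (n : ℝ) ^ (-τ)) := by

  have hu := CovShift.momentExponent_pos hd hβ0 hγ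
  obtain ⟨hr0, hr1, -⟩ := CovShift.rateExponent_eq hd hβ0 hγ
  have hperm := CovShift.log_permConst_nonneg d
  set r := CovShift.rateExponent d β γ with hr
  set u := CovShift.momentExponent d β γ with hu'
  set c := Real.log (CovShift.permConst d) + 2 * d + τ + 1 with hc
  have hc1 : τ + 1 ≤ c := by
    have : (0 : ℝ) ≤ 2 * d := by positivity
    linarith
  have hc0 : 0 < c := by linarith
  have hδ : 0 < (13 * κ) ^ u - (8 * κ) ^ u :=
    sub_pos.2 (Real.rpow_lt_rpow (by positivity) (by linarith) hu)
  -- The threshold `8 * c` makes the optimal `θ` admissible, and `δ` is the gap reserved for the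
  -- sparse points. Both involve only `d, β, γ, κ, τ`.
  obtain ⟨N, hN⟩ := Filter.eventually_atTop.1
    (CovShift.eventually_neighbourCount (τ := τ) (c := 8 * c) hr0 hr1 hκ hδ)
  refine ⟨max N (max (2 * d) 3), by omega, by omega, fun n hn => ?_⟩
  obtain ⟨hone, hkn, hck, hexp⟩ := hN n (by omega)
  have hn3 : 3 ≤ n := by omega
  have hk : 0 < CovShift.neighbourCount κ r n := Nat.ceil_pos.2 (by linarith)
  refine ⟨⟨hk, hkn⟩, ?_⟩
  intro F L lam0 sig0 pbar am rm ap rp ρ K hF hL hlam hsig hpbar ham hrm hap hrp hρ hK P Q p q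
    hP hQ f ν hf hν Ω _ μ _ S hS hind
  have hkl : κ * Real.log n ^ (1 - r) * (n : ℝ) ^ r ≤ (CovShift.neighbourCount κ r n : ℕ) :=
    Nat.le_ceil _
  have hku : ((CovShift.neighbourCount κ r n : ℕ) : ℝ)
      ≤ 2 * (κ * Real.log n ^ (1 - r) * (n : ℝ) ^ r) := by
    have : ((CovShift.neighbourCount κ r n : ℕ) : ℝ) < κ * Real.log n ^ (1 - r) * (n : ℝ) ^ r + 1 :=
      Nat.ceil_lt_add_one (by linarith)
    linarith
  set k := CovShift.neighbourCount κ r n with hkdef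
  have hn0 : (0 : ℝ) < n := by positivity
  have hk0 : (0 : ℝ) < k := by positivity
  have hl0 : 0 < Real.log n := Real.log_pos (by exact_mod_cast (by omega : 1 < n))
  have := hP.isProb
  have := hQ.isProb
  have := hν.isProb
  have hfm := (hf.continuous hβ0).measurable
  have hs1 := hν.one_le hlam
  -- the law of the sample
  have hSm : ∀ i, AEMeasurable (S i) μ := fun i => (hS i).aemeasurable
  have hlaw : μ.map (fun ω i => S i ω)
      = Measure.pi (fun _ : Fin n => CovShift.regressionLaw P f ν) := by
    rw [(iIndepFun_iff_map_fun_eq_pi_map hSm).1 hind]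
    congr 1
    funext i
    exact (hS i).map_eq
  -- the two exceptional sets of samples
  have hH : 0 < lam0 ^ 2 / (8 * sig0) := by positivity
  -- Chosen so that the noise tail is exactly `2 n^(-c)`.
  set v := c * Real.log n / (lam0 ^ 2 / (8 * sig0) * k) with hv
  have hv0 : 0 < v := by positivity
  set t := Real.sqrt v with ht
  have ht0 : 0 < t := Real.sqrt_pos.2 hv0
  have ht2 : t ^ 2 = v := Real.sq_sqrt hv0.le
  have htl : t * lam0 ≤ sig0 := by
    refine abs_le_of_sq_le_sq' ?_ hsig.le |>.2
    have e : (t * lam0) ^ 2 = sig0 * (8 * c * Real.log n) / k := by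
      rw [mul_pow, ht2, hv]
      field_simp
    rw [e, div_le_iff₀ hk0]
    -- Here `lam0` has cancelled, and `sig0 ≥ 1` removes the dependence of the threshold on the
    -- noise.
    calc sig0 * (8 * c * Real.log n) ≤ sig0 * k := by gcongr
      _ ≤ sig0 ^ 2 * k := by
        gcongr
        nlinarith
  have hnoise := CovShift.measure_noise_ge_le (n := n) hk hlam ht0 htl P Q ν hν hfm
  have hm : (0 : ℝ) < 4 * k / n := by positivity
  have hsparse := CovShift.measure_sparseSet_ge_le (k := k) (by omega : 0 < n) P Q ν hfm
    (CovShift.measurableSet_denseSet hP.measurable am rm (4 * k / n))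
    (CovShift.measurable_massRadius hP.measurable am rm (4 * k / n))
    (fun x hx => hP.ofReal_le_measure_massRadius hd ham hrm hm hx)
    (Real.rpow_pos_of_pos hn0 τ)
  set bad1 : Set (Fin n → CovShift.Cov d × ℝ) :=
    {s | ENNReal.ofReal (t ^ 2) ≤ ∫⁻ x, ENNReal.ofReal (CovShift.noiseMean k f s x ^ 2) ∂Q}
  set bad2 : Set (Fin n → CovShift.Cov d × ℝ) :=
    {s | ENNReal.ofReal (Real.exp (-k) * (n : ℝ) ^ τ) ≤
      Q (CovShift.sparseSet k (CovShift.denseSet p am rm (4 * k / n))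
        (CovShift.massRadius p am rm (4 * k / n)) s)}
  have hTtop : CovShift.densityRatioMoment p q u < ∞ :=
    CovShift.densityRatioMoment_lt_top hP.toHasBoundedDensity hpbar hu (min_le_right _ _)
      hQ.densityRatio
  have hTlow : (am * rm ^ d) ^ u ≤ (CovShift.densityRatioMoment p q u).toReal :=
    (ENNReal.ofReal_le_iff_le_toReal hTtop.ne).1
      (hP.rpow_le_densityRatioMoment hQ.toHasBoundedDensity ham hrm hu)
  have hgood : ∀ s : Fin n → CovShift.Cov d × ℝ, s ∉ bad1 → s ∉ bad2 →
      CovShift.l2Risk Q (CovShift.knnRegressor (fun _ => k) s) f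
        ≤ ENNReal.ofReal (CovShift.riskConst d β γ F L am rm lam0 sig0 κ τ K
          (CovShift.densityRatioMoment p q u).toReal * (Real.log n / n) ^ r) := by
    intro s h1 h2
    have h1' : ∫⁻ x, ENNReal.ofReal (CovShift.noiseMean k f s x ^ 2) ∂Q ≤ ENNReal.ofReal (t ^ 2) :=
      le_of_not_ge fun h => h1 h
    have h2' : Q (CovShift.sparseSet k (CovShift.denseSet p am rm (4 * k / n))
        (CovShift.massRadius p am rm (4 * k / n)) s)
        ≤ ENNReal.ofReal (Real.exp (-k) * (n : ℝ) ^ τ) :=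
      le_of_not_ge fun h => h2 h
    refine (CovShift.l2Risk_knnRegressor_le hd hf hβ0 hγ hF hL ham hrm hm hk hkn hP.nonneg
      hP.measurable hQ.toHasBoundedDensity s).trans ?_
    refine le_trans ?_ (ENNReal.ofReal_le_ofReal (CovShift.risk_terms_le (F := F) (L := L)
      hd hn3 hk hβ0 hγ hκ hτ ham hrm hlam hsig hK hc hkl hku hTlow hexp))
    have hA : 0 ≤ (2 * L ^ 2 * rm ^ (2 * β) + 8 * F ^ 2)
        * (4 * k / n / (am * rm ^ d)) ^ CovShift.momentExponent d β γ := by positivity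
    rw [ENNReal.ofReal_add (by positivity) (by positivity),
      ENNReal.ofReal_add (by positivity) (by positivity),
      ENNReal.ofReal_mul hA, ENNReal.ofReal_toReal hTtop.ne,
      ENNReal.ofReal_mul (by positivity : (0 : ℝ) ≤ 8 * F ^ 2),
      ENNReal.ofReal_mul (by norm_num : (0 : ℝ) ≤ 2), ENNReal.ofReal_ofNat, ← hv, ← ht2]
    gcongr
  have hsub : {ω | ¬ CovShift.l2Risk Q (CovShift.knnRegressor (fun _ => k) (fun i => S i ω)) f
        ≤ ENNReal.ofReal (CovShift.riskConst d β γ F L am rm lam0 sig0 κ τ K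
          (CovShift.densityRatioMoment p q u).toReal * (Real.log n / n) ^ r)}
      ⊆ (fun ω i => S i ω) ⁻¹' (bad1 ∪ bad2) := by
    intro ω hω
    by_contra hcon
    rw [Set.mem_preimage, Set.mem_union, not_or] at hcon
    exact hω (hgood _ hcon.1 hcon.2)
  have hb1 : ENNReal.ofReal (2 * Real.exp (-(lam0 ^ 2 / (8 * sig0) * k * t ^ 2)))
      ≤ ENNReal.ofReal ((n : ℝ) ^ (-τ)) := by
    apply ENNReal.ofReal_le_ofReal
    have e : lam0 ^ 2 / (8 * sig0) * k * t ^ 2 = Real.log n * c := by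
      rw [ht2, hv]
      field_simp
    have hn1 : (1 : ℝ) ≤ n := by exact_mod_cast (by omega : 1 ≤ n)
    have hn2 : (2 : ℝ) ≤ n := by exact_mod_cast (by omega : 2 ≤ n)
    -- The extra `1` in `c` pays for the factor `2`, as `2 ≤ n`.
    calc _ = 2 * (n : ℝ) ^ (-c) := by
          rw [e, Real.rpow_def_of_pos hn0, mul_neg]
      _ ≤ (n : ℝ) * (n : ℝ) ^ (-(τ + 1)) := by
          gcongr
      _ = (n : ℝ) ^ (1 + -(τ + 1)) := by rw [Real.rpow_add hn0, Real.rpow_one]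
      _ = _ := by ring_nf
  calc _ ≤ μ ((fun ω i => S i ω) ⁻¹' (bad1 ∪ bad2)) := measure_mono hsub
    -- This inequality holds for arbitrary sets, so the exceptional sets need no measurability
    -- proof.
    _ ≤ μ.map (fun ω i => S i ω) (bad1 ∪ bad2) :=
        Measure.le_map_apply (aemeasurable_pi_lambda _ hSm) _
    _ ≤ ENNReal.ofReal ((n : ℝ) ^ (-τ)) + ENNReal.ofReal ((n : ℝ) ^ (-τ)) := by
        rw [hlaw]
        refine (measure_union_le _ _).trans (add_le_add (hnoise.trans hb1) ?_)
        rw [Real.rpow_neg hn0.le]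
        exact hsparse
    _ = _ := by
        rw [← ENNReal.ofReal_add (by positivity) (by positivity), two_mul]
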